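/- **Proposition ($q$-Racah limit).** Let $\theta_1,\dots,\theta_4$ be the Jacobi theta functions of nome $p$, $0<p<1$: $$\theta_1(z)=2\sum_{n\ge0}(-1)^np^{(n+\frac12)^2}\sin(2n+1)z,\qquad \theta_2(z)=2\sum_{n\ge0}p^{(n+\frac12)^2}\cos(2n+1)z,$$ $$\theta_3(z)=1+2\sum_{n\ge1}p^{n^2}\cos 2nz,\qquad \theta_4(z)=1+2\sum_{n\ge1}(-1)^np^{n^2}\cos 2nz,$$ and for $\alpha>0$ put $[z]_1=\theta_1(\frac\alpha2z)/(\frac\alpha2\theta_1'(0))$ and $[z]_r=\theta_r(\frac\alpha2z)/\theta_r(0)$ for $r=2,3,4$. Let $\pi_1=\mathrm{id}$, $\pi_2=(12)(34)$, $\pi_3=(13)(24)$, $\pi_4=(14)(23)$. Let $m\ge1$ be an integer and let $u_1,\dots,u_4,v_1,\dots,v_4$ be real with $u_r>0$ and $|v_r|<u_r+\frac12$ for $r=1,2$; suppose moreover that $v_r=0$ whenever $u_r=\frac12$ ($r=1,2$). Put $\alpha=\pi/(u_1+u_2+m)$ and let $u$ be real with $u,u+1\notin\frac{2\pi}{\alpha}\mathbb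 Z$. Define $$A(z)=\prod_{r=1}^4\frac{[z+u_r]_r}{[z]_r}\frac{[z+\frac12+v_r]_r}{[z+\frac12]_r},\qquad B(z)=\sum_{r=1}^4c_r\frac{[z+\frac12+u]_r}{[z+\frac12]_r}\frac{[z-\frac12-u]_r}{[z-\frac12]_r},$$ $$c_r=\frac{2}{[u]_1[u+1]_1}\prod_{s=1}^4[u_{\pi_r(s)}-\tfrac12]_s\,[v_{\pi_r(s)}]_s$$ (where a summand of $B$ with $c_r=0$ is zero), and $a_k=A(-u_1-k)$, $\tilde a_k=A(u_1+m-k)$, $b_k=B(u_1+k)$. Let $\mathbf H=(H_{i,j})_{0\le i,j\le m}$ be the tridiagonal matrix with $H_{i,i}=b_i$, $H_{i,i+1}=\tilde a_{m-i}$, $H_{i,i-1}=a_i$. Let $E_0\ge E_1\ge\cdots$ be the real eigenvalues of $\mathbf H$ (with multiplicity), let $p_k(E)$ be the leading principal $k\times k$ minor of $E\,\mathbf I-\mathbf H$ (with $p_0=1$), and let $f_k(E)=p_k(E)\prod_{0\le j<k}\tilde a_{m-j}^{-1}$ be the normalized elliptic Racah polynomials, $0\le k\le m$. Put $$c_{t,r}=\frac{2\sin\left(\frac\alpha2(u_{\pi_r(1)}-\frac12)\right)\sin\left(\frac\alpha2v_{\pi_r(1)}\right)\cos\left(\frac\alpha2(u_{\pi_r(2)}-\frac12)\right)\cos\left(\frac\alpha2v_{\pi_r(2)}\right)}{\sin(\frac\alpha2u)\sin(\frac\alpha2(u+1))}.$$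 (i) For all sufficiently small $p>0$ the matrix $\mathbf H$ has $m+1$ distinct real eigenvalues $E_0>E_1>\dots>E_m$, and for $0\le j\le m$ $$\lim_{p\to0^+}E_j=2\cos\tfrac\alpha2(2j+u_1+u_2+v_1+v_2)+\sum_{r=1}^4c_{t,r}.$$ (ii) Let $q=e^{i\alpha}$ and $q^y=e^{i\alpha y}$. For $0\le k\le m$, every $x\in\mathbb C$ and $E=2\cos\frac\alpha2(2x+u_1+u_2+v_1+v_2)+\sum_{r=1}^4c_{t,r}$, $$\lim_{p\to0^+}f_k(E)=R_k(x;a,b,c,d\,|\,q)={}_4\phi_3\left({q^{-k},\,q^{2u_1+k},\,q^{-x},\,q^{u_1+u_2+v_1+v_2+x}\atop -q^{u_1+u_2},\,q^{u_1+v_1+1/2},\,-q^{u_1+v_2+1/2}};q,q\right),$$ with $a=-q^{u_1+u_2-1}$, $b=-q^{u_1-u_2}$, $c=-q^{u_1+v_2-1/2}$, $d=-q^{u_2+v_1-1/2}$. Here $R_k$ is the $q$-Racah polynomial $$R_k(x;a,b,c,d\,|\,q)={}_4\phi_3\left({q^{-k},\,abq^{k+1},\,q^{-x},\,cdq^{x+1}\atop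 aq,\,bdq,\,cq};q,q\right),$$ ${}_4\phi_3\left({a_1,a_2,a_3,a_4\atop b_1,b_2,b_3};q,z\right)=\sum_{l\ge0}\frac{(a_1;q)_l(a_2;q)_l(a_3;q)_l(a_4;q)_l}{(b_1;q)_l(b_2;q)_l(b_3;q)_l(q;q)_l}z^l$ and $(z;q)_l=\prod_{0\le i<l}(1-zq^i)$, where the series with upper parameter $q^{-k}$ stops at $l=k$. -/

import Mathlib

open Filter Topology

noncomputable section

namespace EllipticRacah

/-! The indices `1, 2, 3, 4` of the paper are the elements `0, 1, 2, 3` of `Fin 4`. -/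

/-! ### Jacobi theta functions of nome `p` and their rescaled, normalized variants -/

/-- `θ₁(z; p)`. -/
def theta1 (p z : ℝ) : ℝ :=
  2 * ∑' n : ℕ, (-1) ^ n * p ^ (((n : ℝ) + 1 / 2) ^ 2) * Real.sin ((2 * n + 1) * z)

/-- `θ₂(z; p)`. -/
def theta2 (p z : ℝ) : ℝ :=
  2 * ∑' n : ℕ, p ^ (((n : ℝ) + 1 / 2) ^ 2) * Real.cos ((2 * n + 1) * z)

/-- `θ₃(z; p)`; the sum over `n ≥ 1` is written as a sum over `n + 1` with `n ≥ 0`. -/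
def theta3 (p z : ℝ) : ℝ :=
  1 + 2 * ∑' n : ℕ, p ^ ((n + 1) ^ 2) * Real.cos (2 * (n + 1) * z)

/-- `θ₄(z; p)`; the sum over `n ≥ 1` is written as a sum over `n + 1` with `n ≥ 0`. -/
def theta4 (p z : ℝ) : ℝ :=
  1 + 2 * ∑' n : ℕ, (-1) ^ (n + 1) * p ^ ((n + 1) ^ 2) * Real.cos (2 * (n + 1) * z)

/-- The scaled theta functions `[z]_r`, with scaling parameter `α` and nome `p`. -/
def bracket (α p : ℝ) (r : Fin 4) (z : ℝ) : ℝ :=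
  ![theta1 p (α / 2 * z) / (α / 2 * deriv (theta1 p) 0),
    theta2 p (α / 2 * z) / theta2 p 0,
    theta3 p (α / 2 * z) / theta3 p 0,
    theta4 p (α / 2 * z) / theta4 p 0] r

/-- The permutations `π₁ = id`, `π₂ = (12)(34)`, `π₃ = (13)(24)`, `π₄ = (14)(23)`. -/
def halfPeriodPerm : Fin 4 → Equiv.Perm (Fin 4) :=
  ![1, Equiv.swap 0 1 * Equiv.swap 2 3, Equiv.swap 0 2 * Equiv.swap 1 3,
    Equiv.swap 0 3 * Equiv.swap 1 2]

/-! ### Coefficients of the difference Heun operator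

`u`, `v` are the coupling parameters and `w` is the virtual regularization parameter
(written `u` without index in the paper). -/

/-- The coefficient `A(z)`. -/
def coefA (α p : ℝ) (u v : Fin 4 → ℝ) (z : ℝ) : ℝ :=
  ∏ r : Fin 4,
    bracket α p r (z + u r) / bracket α p r z *
      (bracket α p r (z + 1 / 2 + v r) / bracket α p r (z + 1 / 2))

/-- The constants `c_r`. -/
def coefC (α p : ℝ) (u v : Fin 4 → ℝ) (w : ℝ) (r : Fin 4) : ℝ :=
  2 / (bracket α p 0 w * bracket α p 0 (w + 1)) *
    ∏ s : Fin 4, bracket α p s (u (halfPeriodPerm r s) - 1 / 2) *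
      bracket α p s (v (halfPeriodPerm r s))

/-- The coefficient `B(z)`. -/
def coefB (α p : ℝ) (u v : Fin 4 → ℝ) (w z : ℝ) : ℝ :=
  ∑ r : Fin 4, coefC α p u v w r *
    (bracket α p r (z + 1 / 2 + w) / bracket α p r (z + 1 / 2)) *
    (bracket α p r (z - 1 / 2 - w) / bracket α p r (z - 1 / 2))

/-- The scaling parameter `α = π / (u₁ + u₂ + m)`. -/
def scaling (m : ℕ) (u : Fin 4 → ℝ) : ℝ := Real.pi / (u 0 + u 1 + m)

/-- `a_k = A(-u₁ - k)`. -/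
def lowerCoef (m : ℕ) (p : ℝ) (u v : Fin 4 → ℝ) (k : ℕ) : ℝ :=
  coefA (scaling m u) p u v (-u 0 - k)

/-- `ã_k = A(u₁ + m - k)`. -/
def upperCoef (m : ℕ) (p : ℝ) (u v : Fin 4 → ℝ) (k : ℕ) : ℝ :=
  coefA (scaling m u) p u v (u 0 + m - k)

/-- `b_k = B(u₁ + k)`. -/
def diagCoef (m : ℕ) (p : ℝ) (u v : Fin 4 → ℝ) (w : ℝ) (k : ℕ) : ℝ :=
  coefB (scaling m u) p u v w (u 0 + k)

/-- The entries `H_{i,j}`, `0 ≤ i, j ≤ m`, of the tridiagonal finite discrete Heun matrix: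
row `i` reads `a_i, b_i, ã_{m-i}`. -/
def heunEntry (m : ℕ) (p : ℝ) (u v : Fin 4 → ℝ) (w : ℝ) (i j : ℕ) : ℝ :=
  if i = j then diagCoef m p u v w i
  else if j = i + 1 then upperCoef m p u v (m - i)
  else if i = j + 1 then lowerCoef m p u v i
  else 0

/-- The finite discrete Heun matrix `H`. -/
def heunMatrix (m : ℕ) (p : ℝ) (u v : Fin 4 → ℝ) (w : ℝ) :
    Matrix (Fin (m + 1)) (Fin (m + 1)) ℝ :=
  Matrix.of fun i j => heunEntry m p u v w i j

/-- `E_j`, `0 ≤ j ≤ m`: the real eigenvalues of `H` (roots of the characteristic polynomial,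
with multiplicity), listed in decreasing order starting with `E_0`. -/
def eigenvalue (m : ℕ) (p : ℝ) (u v : Fin 4 → ℝ) (w : ℝ) (j : ℕ) : ℝ :=
  ((heunMatrix m p u v w).charpoly.roots.sort (· ≥ ·)).getD j 0

/-- The monic elliptic Racah polynomial `p_k(E)`, `0 ≤ k ≤ m + 1`: the leading principal
`k × k` minor of `E I - H`. -/
def monicPoly (m : ℕ) (p : ℝ) (u v : Fin 4 → ℝ) (w : ℝ) (k : ℕ) (E : ℂ) : ℂ :=
  Matrix.det (Matrix.of fun i j : Fin k =>
    (if i = j then E else 0) - (heunEntry m p u v w i j : ℂ))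

/-- The normalized elliptic Racah polynomial `f_k(E)`, `0 ≤ k ≤ m`. -/
def normalizedPoly (m : ℕ) (p : ℝ) (u v : Fin 4 → ℝ) (w : ℝ) (k : ℕ) (E : ℂ) : ℂ :=
  monicPoly m p u v w k E * ∏ j ∈ Finset.range k, ((upperCoef m p u v (m - j) : ℂ))⁻¹

/-! ### The trigonometric limit -/

/-- The constants `c_{t,r}`. -/
def trigC (α : ℝ) (u v : Fin 4 → ℝ) (w : ℝ) (r : Fin 4) : ℝ :=
  2 * Real.sin (α / 2 * (u (halfPeriodPerm r 0) - 1 / 2)) *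
      Real.sin (α / 2 * v (halfPeriodPerm r 0)) *
      Real.cos (α / 2 * (u (halfPeriodPerm r 1) - 1 / 2)) *
      Real.cos (α / 2 * v (halfPeriodPerm r 1)) /
    (Real.sin (α / 2 * w) * Real.sin (α / 2 * (w + 1)))

/-- The value `2 cos((α/2)(2x + u₁ + u₂ + v₁ + v₂)) + ∑ c_{t,r}` of the spectral parameter,
for complex `x`. -/
def trigE (m : ℕ) (u v : Fin 4 → ℝ) (w : ℝ) (x : ℂ) : ℂ :=
  2 * Complex.cos (scaling m u / 2 * (2 * x + u 0 + u 1 + v 0 + v 1)) +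
    ∑ r : Fin 4, (trigC (scaling m u) u v w r : ℂ)

/-- The `q`-shifted factorial `(z; q)_l`. -/
def qPoch (z q : ℂ) (l : ℕ) : ℂ := ∏ i ∈ Finset.range l, (1 - z * q ^ i)

/-- The basic hypergeometric series `₄φ₃(a₁, a₂, a₃, a₄; b₁, b₂, b₃; q, z)`. -/
def phi43 (a₁ a₂ a₃ a₄ b₁ b₂ b₃ q z : ℂ) : ℂ :=
  ∑' l : ℕ, qPoch a₁ q l * qPoch a₂ q l * qPoch a₃ q l * qPoch a₄ q l /
    (qPoch b₁ q l * qPoch b₂ q l * qPoch b₃ q l * qPoch q q l) * z ^ l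

/-- The `q`-Racah polynomial `R_k(x(x); a, b, c, d | q)`, `x(x) = c d q^{x+1} + q^{-x}`.
Complex powers of `q` are principal: for `q = e^{iα}` with `0 < α < π` one has
`q^y = e^{iαy}`. -/
def qRacah (k : ℕ) (x a b c d q : ℂ) : ℂ :=
  phi43 (q ^ (-(k : ℂ))) (a * b * q ^ (k + 1)) (q ^ (-x)) (c * d * q ^ (x + 1))
    (a * q) (b * d * q) (c * q) q q

end EllipticRacah

end

noncomputable section

namespace EllipticRacah

/-! ### Degeneration of the theta functions at `p = 0` -/

/-! As p → 0 the brackets tend to sin(αz/2)/(α/2), cos(αz/2), 1 and 1, because the common factor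
p^(1/4) of θ₁ and θ₂ cancels in the quotients and dominated convergence leaves only the leading term
of each series. The entries of H therefore converge, and everything reduces to a trigonometric
tridiagonal matrix.

The diagonal of the limit splits into the constant ∑ c_{t,r}, which alone contains the
regularization parameter, and a part β(z). By partial fractions (`trig_partial_fractions`), A(z) +
A(-z) + β(z) = 2cos((α/2)(u₁+u₂+v₁+v₂)). Up to a shift, each row of the limit matrix thus has the
form A(f_{k+1} - f_k) + C(f_{k-1} - f_k). In exponential form, A and C are the coefficients of the
q-Racah recurrence in the degree k, divided by the square root of cdq (`racah_upper_coefficient`,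
`racah_lower_coefficient`). That recurrence (`racahSum_recurrence`) is checked coefficient by
coefficient in the basis (q^{-x};q)_l (cdq^{x+1};q)_l.

For (ii), the leading minors of E - H solve the same three-term recurrence after normalization, and
determinants are continuous. For (i), when x = j ∈ {0,…,m} the recurrence also holds in the last
row, where the superdiagonal coefficient A(u₁+m) is zero. The m + 1 values of E at these x are thus
roots of the limiting characteristic polynomial, and they are strictly decreasing in j, hence all
its roots. Since H is not symmetric, that its eigenvalues are real for small p comes from sign
changes of the characteristic polynomial around these simple roots (`sort_roots_tendsto`). -/

/-- Dominated convergence on p < 1/2: as n ≤ e n, the terms are bounded by (1/2)^n (2n+1). The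
linear growth allowed for c covers the differentiated series of θ₁. -/
lemma tendsto_tsum_pow (e : ℕ → ℕ) (he : ∀ n, n ≤ e n) (c : ℕ → ℝ)
    (hc : ∀ n, |c n| ≤ 2 * n + 1) :
    Tendsto (fun p : ℝ => ∑' n, p ^ e n * c n) (𝓝[>] 0)
      (𝓝 (∑' n, if e n = 0 then c n else 0)) := by
  have hb : Summable fun n : ℕ => (1 / 2 : ℝ) ^ n * (2 * n + 1) := by
    have h1 : Summable fun n : ℕ => ((n : ℝ) ^ 1 * (1 / 2 : ℝ) ^ n) :=
      summable_pow_mul_geometric_of_norm_lt_one 1 (by norm_num)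
    have h2 : Summable fun n : ℕ => (1 / 2 : ℝ) ^ n :=
      summable_geometric_of_lt_one (by norm_num) (by norm_num)
    refine ((h1.mul_left 2).add h2).congr fun n => ?_
    ring
  refine tendsto_tsum_of_dominated_convergence hb (fun n => ?_) ?_
  · have h : Tendsto (fun p : ℝ => p ^ e n * c n) (𝓝 0) (𝓝 ((0 : ℝ) ^ e n * c n)) :=
      (((continuous_id.pow (e n)).mul continuous_const).tendsto (0 : ℝ))
    have he : (if e n = 0 then c n else 0) = (0 : ℝ) ^ e n * c n := by
      by_cases h0 : e n = 0 <;> simp [h0]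
    rw [he]
    exact h.mono_left nhdsWithin_le_nhds
  · have : ∀ᶠ p : ℝ in 𝓝[>] 0, p < 1 / 2 :=
      nhdsWithin_le_nhds (eventually_lt_nhds (by norm_num))
    filter_upwards [this, self_mem_nhdsWithin] with p hp hp0 n
    have hp0 : 0 < p := hp0
    rw [Real.norm_eq_abs, abs_mul, abs_pow, abs_of_pos hp0]
    gcongr
    · calc p ^ e n ≤ p ^ n := pow_le_pow_of_le_one hp0.le (by linarith) (he n)
        _ ≤ (1 / 2) ^ n := by gcongr
    · exact hc n

lemma rpow_add_half_sq {p : ℝ} (hp : 0 < p) (n : ℕ) :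
    p ^ (((n : ℝ) + 1 / 2) ^ 2) = p ^ (1 / 4 : ℝ) * p ^ (n * (n + 1)) := by
  rw [← Real.rpow_natCast p, ← Real.rpow_add hp]
  push_cast
  ring_nf

lemma tendsto_tsum_odd (c : ℕ → ℝ) (hc : ∀ n, |c n| ≤ 2 * n + 1) :
    Tendsto (fun p : ℝ => ∑' n : ℕ, p ^ (n * (n + 1)) * c n) (𝓝[>] 0) (𝓝 (c 0)) := by
  have h := tendsto_tsum_pow (fun n => n * (n + 1)) (fun n => by nlinarith) c hc
  convert h using 2
  rw [tsum_eq_single 0]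
  · simp
  · intro n hn
    simp [hn]

lemma tendsto_tsum_even (c : ℕ → ℝ) (hc : ∀ n, |c n| ≤ 1) :
    Tendsto (fun p : ℝ => ∑' n : ℕ, p ^ ((n + 1) ^ 2) * c n) (𝓝[>] 0) (𝓝 0) := by
  have h := tendsto_tsum_pow (fun n => (n + 1) ^ 2) (fun n => by nlinarith) c
    (fun n => (hc n).trans (by linarith [n.cast_nonneg (α := ℝ)]))
  simpa using h

lemma theta1_eq {p : ℝ} (hp : 0 < p) (z : ℝ) :
    theta1 p z = p ^ (1 / 4 : ℝ) *
      (2 * ∑' n : ℕ, p ^ (n * (n + 1)) * ((-1) ^ n * Real.sin ((2 * n + 1) * z))) := by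
  rw [theta1, mul_left_comm, ← tsum_mul_left (a := p ^ (1 / 4 : ℝ))]
  congr 1
  refine tsum_congr fun n => ?_
  rw [rpow_add_half_sq hp]
  ring

lemma theta2_eq {p : ℝ} (hp : 0 < p) (z : ℝ) :
    theta2 p z = p ^ (1 / 4 : ℝ) *
      (2 * ∑' n : ℕ, p ^ (n * (n + 1)) * Real.cos ((2 * n + 1) * z)) := by
  rw [theta2, mul_left_comm, ← tsum_mul_left (a := p ^ (1 / 4 : ℝ))]
  congr 1
  refine tsum_congr fun n => ?_
  rw [rpow_add_half_sq hp]
  ring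

lemma summable_nome {p : ℝ} (hp : 0 < p) (hp1 : p < 1) :
    Summable fun n : ℕ => p ^ (n * (n + 1)) * (2 * (n : ℝ) + 1) := by
  have h1 : Summable fun n : ℕ => ((n : ℝ) ^ 1 * p ^ n) :=
    summable_pow_mul_geometric_of_norm_lt_one 1 (by rwa [Real.norm_eq_abs, abs_of_pos hp])
  have h2 : Summable fun n : ℕ => p ^ n := summable_geometric_of_lt_one hp.le hp1
  refine Summable.of_nonneg_of_le (fun n => by positivity) (fun n => ?_)
    ((h1.mul_left 2).add h2)
  calc p ^ (n * (n + 1)) * (2 * (n : ℝ) + 1) ≤ p ^ n * (2 * (n : ℝ) + 1) := by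
        gcongr ?_ * _
        exact pow_le_pow_of_le_one hp.le hp1.le (by nlinarith)
    _ = _ := by ring

lemma deriv_theta1_zero {p : ℝ} (hp : 0 < p) (hp1 : p < 1) :
    deriv (theta1 p) 0 = p ^ (1 / 4 : ℝ) *
      (2 * ∑' n : ℕ, p ^ (n * (n + 1)) * ((-1) ^ n * (2 * (n : ℝ) + 1))) := by
  have hd : ∀ (n : ℕ) (z : ℝ), HasDerivAt
      (fun z => p ^ (n * (n + 1)) * ((-1) ^ n * Real.sin ((2 * n + 1) * z)))
      (p ^ (n * (n + 1)) * ((-1) ^ n * (Real.cos ((2 * n + 1) * z) * (2 * n + 1)))) z := by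
    intro n z
    have h := ((hasDerivAt_id z).const_mul (2 * (n : ℝ) + 1)).sin
    simpa using (h.const_mul ((-1 : ℝ) ^ n)).const_mul (p ^ (n * (n + 1)))
  have key := hasDerivAt_tsum (summable_nome hp hp1) hd (fun n z => by
    simp only [norm_mul, norm_pow, norm_neg, norm_one, one_pow, one_mul, Real.norm_eq_abs]
    rw [abs_of_pos hp, abs_of_pos (by positivity : (0 : ℝ) < 2 * n + 1)]
    gcongr
    exact mul_le_of_le_one_left (by positivity) (Real.abs_cos_le_one _))
    (y₀ := 0) (by simp) 0
  have h := (key.const_mul 2).const_mul (p ^ (1 / 4 : ℝ))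
  have hfun : theta1 p = fun z => p ^ (1 / 4 : ℝ) *
      (2 * ∑' n : ℕ, p ^ (n * (n + 1)) * ((-1) ^ n * Real.sin ((2 * n + 1) * z))) :=
    funext (theta1_eq hp)
  rw [hfun, h.deriv]
  simp

lemma tendsto_div_of_eventually_factor {f g F G s : ℝ → ℝ} {a b : ℝ} {l : Filter ℝ}
    (hf : ∀ᶠ p in l, f p = s p * F p) (hg : ∀ᶠ p in l, g p = s p * G p)
    (hs : ∀ᶠ p in l, s p ≠ 0) (hF : Tendsto F l (𝓝 a)) (hG : Tendsto G l (𝓝 b)) (hb : b ≠ 0) :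
    Tendsto (fun p => f p / g p) l (𝓝 (a / b)) := by
  refine (hF.div hG hb).congr' ?_
  filter_upwards [hf, hg, hs] with p h1 h2 h3
  rw [h1, h2, Pi.div_apply, mul_div_mul_left _ _ h3]

lemma abs_neg_one_pow_mul_le (n : ℕ) {x y : ℝ} (h : |x| ≤ y) : |(-1) ^ n * x| ≤ y := by
  simpa [abs_mul] using h

/-- The limit of `[z]_r` for `p → 0`. -/
def trigBracket (α : ℝ) (r : Fin 4) (z : ℝ) : ℝ :=
  ![Real.sin (α / 2 * z) / (α / 2), Real.cos (α / 2 * z), 1, 1] r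

lemma tendsto_bracket {α : ℝ} (hα : α ≠ 0) (r : Fin 4) (z : ℝ) :
    Tendsto (fun p => bracket α p r z) (𝓝[>] 0) (𝓝 (trigBracket α r z)) := by
  have hpos : ∀ᶠ p : ℝ in 𝓝[>] 0, 0 < p := self_mem_nhdsWithin
  have hlt : ∀ᶠ p : ℝ in 𝓝[>] 0, p < 1 :=
    nhdsWithin_le_nhds (eventually_lt_nhds (by norm_num))
  have hs : ∀ᶠ p : ℝ in 𝓝[>] 0, p ^ (1 / 4 : ℝ) ≠ 0 := by
    filter_upwards [hpos] with p hp using (Real.rpow_pos_of_pos hp _).ne'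
  have hodd : ∀ n : ℕ, (1 : ℝ) ≤ 2 * n + 1 := fun n => by linarith [n.cast_nonneg (α := ℝ)]
  -- θ₃ and θ₄ together: both series are O(p), so numerator and denominator tend to 1.
  have heven : ∀ (f : ℝ → ℕ → ℝ → ℝ) (c : ℕ → ℝ → ℝ),
      (∀ p n z, f p n z = p ^ ((n + 1) ^ 2) * c n z) → (∀ n z, |c n z| ≤ 1) →
      Tendsto (fun p => (1 + 2 * ∑' n, f p n (α / 2 * z)) / (1 + 2 * ∑' n, f p n 0))
        (𝓝[>] 0) (𝓝 1) := by
    intro f c hf hc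
    have h : ∀ y, Tendsto (fun p => 1 + 2 * ∑' n, f p n y) (𝓝[>] 0) (𝓝 (1 + 2 * 0)) := by
      intro y
      simp only [hf]
      exact ((tendsto_tsum_even _ fun n => hc n y).const_mul 2).const_add 1
    have h' := (h (α / 2 * z)).div (h 0) (by norm_num)
    rw [mul_zero, add_zero, div_one] at h'
    exact h'
  fin_cases r
  · have h1 := (tendsto_tsum_odd (fun n => (-1) ^ n * Real.sin ((2 * n + 1) * (α / 2 * z)))
      fun n => abs_neg_one_pow_mul_le n ((Real.abs_sin_le_one _).trans (hodd n))).const_mul 2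
    have h2 := ((tendsto_tsum_odd (fun n => (-1) ^ n * (2 * (n : ℝ) + 1))
      fun n => abs_neg_one_pow_mul_le n (abs_of_pos (by positivity)).le).const_mul 2).const_mul
        (α / 2)
    have := tendsto_div_of_eventually_factor (f := fun p => theta1 p (α / 2 * z))
      (g := fun p => α / 2 * deriv (theta1 p) 0) (s := fun p => p ^ (1 / 4 : ℝ))
      (by filter_upwards [hpos] with p hp using theta1_eq hp _)
      (by
        filter_upwards [hpos, hlt] with p hp hp1
        rw [deriv_theta1_zero hp hp1]
        ring) hs h1 h2 (by simpa using hα)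
    change Tendsto (fun p => theta1 p (α / 2 * z) / (α / 2 * deriv (theta1 p) 0)) _
      (𝓝 (Real.sin (α / 2 * z) / (α / 2)))
    convert this using 2
    simp
    field_simp
  · have h1 := (tendsto_tsum_odd (fun n => Real.cos ((2 * n + 1) * (α / 2 * z)))
      fun n => (Real.abs_cos_le_one _).trans (hodd n)).const_mul 2
    have h2 := (tendsto_tsum_odd (fun n => Real.cos ((2 * n + 1) * 0))
      fun n => (Real.abs_cos_le_one _).trans (hodd n)).const_mul 2
    have := tendsto_div_of_eventually_factor (f := fun p => theta2 p (α / 2 * z))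
      (g := fun p => theta2 p 0) (s := fun p => p ^ (1 / 4 : ℝ))
      (by filter_upwards [hpos] with p hp using theta2_eq hp _)
      (by filter_upwards [hpos] with p hp using theta2_eq hp _) hs h1 h2 (by simp)
    change Tendsto (fun p => theta2 p (α / 2 * z) / theta2 p 0) _ (𝓝 (Real.cos (α / 2 * z)))
    convert this using 2
    simp
  · exact heven (fun p n z => p ^ ((n + 1) ^ 2) * Real.cos (2 * (n + 1) * z))
      (fun n z => Real.cos (2 * (n + 1) * z)) (fun p n z => rfl)
      (fun n z => Real.abs_cos_le_one _)
  · exact heven (fun p n z => (-1) ^ (n + 1) * p ^ ((n + 1) ^ 2) * Real.cos (2 * (n + 1) * z))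
      (fun n z => (-1) ^ (n + 1) * Real.cos (2 * (n + 1) * z)) (fun p n z => by ring)
      (fun n z => abs_neg_one_pow_mul_le _ (Real.abs_cos_le_one _))

/-! ### Limits of the coefficients A and B -/

lemma bracket_zero_zero (α p : ℝ) : bracket α p 0 0 = 0 := by
  simp [bracket, theta1]

/-- The limit of `A(z)` for `p → 0`. -/
def trigA (α : ℝ) (u v : Fin 4 → ℝ) (z : ℝ) : ℝ :=
  Real.sin (α / 2 * (z + u 0)) / Real.sin (α / 2 * z) *
    (Real.sin (α / 2 * (z + 1 / 2 + v 0)) / Real.sin (α / 2 * (z + 1 / 2))) *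
  (Real.cos (α / 2 * (z + u 1)) / Real.cos (α / 2 * z) *
    (Real.cos (α / 2 * (z + 1 / 2 + v 1)) / Real.cos (α / 2 * (z + 1 / 2))))

lemma trigBracket_ne_zero {α : ℝ} (hα : α ≠ 0) {z : ℝ} (hs : Real.sin (α / 2 * z) ≠ 0)
    (hc : Real.cos (α / 2 * z) ≠ 0) (r : Fin 4) : trigBracket α r z ≠ 0 := by
  fin_cases r <;> simp [trigBracket, hs, hc, hα]

lemma tendsto_coefA {α : ℝ} (hα : α ≠ 0) (u v : Fin 4 → ℝ) {z : ℝ}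
    (h1 : Real.sin (α / 2 * z) ≠ 0) (h2 : Real.cos (α / 2 * z) ≠ 0)
    (h3 : Real.sin (α / 2 * (z + 1 / 2)) ≠ 0) (h4 : Real.cos (α / 2 * (z + 1 / 2)) ≠ 0) :
    Tendsto (fun p => coefA α p u v z) (𝓝[>] 0) (𝓝 (trigA α u v z)) := by
  have h : Tendsto (fun p => coefA α p u v z) (𝓝[>] 0) (𝓝 (∏ r : Fin 4,
      trigBracket α r (z + u r) / trigBracket α r z *
      (trigBracket α r (z + 1 / 2 + v r) / trigBracket α r (z + 1 / 2)))) :=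
    tendsto_finsetProd _ fun r _ =>
      ((tendsto_bracket hα r _).div (tendsto_bracket hα r _)
        (trigBracket_ne_zero hα h1 h2 r)).mul
      ((tendsto_bracket hα r _).div (tendsto_bracket hα r _)
        (trigBracket_ne_zero hα h3 h4 r))
  convert h using 2
  have hα2 : α / 2 ≠ 0 := by simpa using hα
  simp only [Fin.prod_univ_four, trigBracket, trigA, Matrix.cons_val_zero, Matrix.cons_val_one,
    Matrix.cons_val, div_one, mul_one, div_div_div_cancel_right₀ hα2]

lemma tendsto_coefC {α : ℝ} (hα : α ≠ 0) (u v : Fin 4 → ℝ) {w : ℝ}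
    (h1 : Real.sin (α / 2 * w) ≠ 0) (h2 : Real.sin (α / 2 * (w + 1)) ≠ 0) (r : Fin 4) :
    Tendsto (fun p => coefC α p u v w r) (𝓝[>] 0) (𝓝 (trigC α u v w r)) := by
  have hα2 : α / 2 ≠ 0 := by simpa using hα
  have h : Tendsto (fun p => coefC α p u v w r) (𝓝[>] 0)
      (𝓝 (2 / (trigBracket α 0 w * trigBracket α 0 (w + 1)) *
        ∏ s : Fin 4, trigBracket α s (u (halfPeriodPerm r s) - 1 / 2) *
          trigBracket α s (v (halfPeriodPerm r s)))) := by
    refine Tendsto.mul (tendsto_const_nhds.div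
      ((tendsto_bracket hα 0 _).mul (tendsto_bracket hα 0 _)) ?_) ?_
    · simp [trigBracket, h1, h2, hα]
    · exact tendsto_finsetProd _ fun s _ =>
        (tendsto_bracket hα s _).mul (tendsto_bracket hα s _)
  convert h using 2
  simp only [Fin.prod_univ_four, trigBracket, trigC, Matrix.cons_val_zero, Matrix.cons_val_one,
    Matrix.cons_val, mul_one]
  field_simp

/-- The part of the limit of `B(z)` that depends on `z`. -/
def trigBeta (α : ℝ) (u v : Fin 4 → ℝ) (z : ℝ) : ℝ :=
  -(2 * Real.sin (α / 2 * (u 0 - 1 / 2)) * Real.sin (α / 2 * v 0) *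
      Real.cos (α / 2 * (u 1 - 1 / 2)) * Real.cos (α / 2 * v 1) /
      (Real.sin (α / 2 * (z + 1 / 2)) * Real.sin (α / 2 * (z - 1 / 2)))) -
  2 * Real.sin (α / 2 * (u 1 - 1 / 2)) * Real.sin (α / 2 * v 1) *
      Real.cos (α / 2 * (u 0 - 1 / 2)) * Real.cos (α / 2 * v 0) /
      (Real.cos (α / 2 * (z + 1 / 2)) * Real.cos (α / 2 * (z - 1 / 2)))

lemma mul_ratio_eq_sub {c s t x y a b : ℝ} (hs : s ≠ 0) (ht : t ≠ 0) (ha : a ≠ 0) (hb : b ≠ 0)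
    (h : x * y = a * b - s * t) :
    c / (s * t) * (x / a) * (y / b) = c / (s * t) - c / (a * b) := by
  field_simp
  linear_combination c * h

/-- The product of the two shifted sines differs from sin(α(z+1/2)/2) sin(α(z-1/2)/2) only by
sin(αw/2) sin(α(w+1)/2). So w survives only in an additive constant independent of z. -/
lemma sin_ratio_mul (α w z c : ℝ)
    (h1 : Real.sin (α / 2 * w) ≠ 0) (h2 : Real.sin (α / 2 * (w + 1)) ≠ 0)
    (h3 : Real.sin (α / 2 * (z + 1 / 2)) ≠ 0) (h4 : Real.sin (α / 2 * (z - 1 / 2)) ≠ 0) :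
    c / (Real.sin (α / 2 * w) * Real.sin (α / 2 * (w + 1))) *
      (Real.sin (α / 2 * (z + 1 / 2 + w)) / Real.sin (α / 2 * (z + 1 / 2))) *
      (Real.sin (α / 2 * (z - 1 / 2 - w)) / Real.sin (α / 2 * (z - 1 / 2))) =
    c / (Real.sin (α / 2 * w) * Real.sin (α / 2 * (w + 1))) -
      c / (Real.sin (α / 2 * (z + 1 / 2)) * Real.sin (α / 2 * (z - 1 / 2))) := by
  have key : Real.sin (α / 2 * (z + 1 / 2 + w)) * Real.sin (α / 2 * (z - 1 / 2 - w)) =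
      Real.sin (α / 2 * (z + 1 / 2)) * Real.sin (α / 2 * (z - 1 / 2)) -
      Real.sin (α / 2 * w) * Real.sin (α / 2 * (w + 1)) := by
    have h := fun a b : ℝ => Real.two_mul_sin_mul_sin a b
    have e1 := h (α / 2 * (z + 1 / 2 + w)) (α / 2 * (z - 1 / 2 - w))
    have e2 := h (α / 2 * (z + 1 / 2)) (α / 2 * (z - 1 / 2))
    have e3 := h (α / 2 * (w + 1)) (α / 2 * w)
    ring_nf at e1 e2 e3 ⊢
    linarith
  exact mul_ratio_eq_sub h1 h2 h3 h4 key

lemma cos_ratio_mul (α w z c : ℝ)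
    (h1 : Real.sin (α / 2 * w) ≠ 0) (h2 : Real.sin (α / 2 * (w + 1)) ≠ 0)
    (h3 : Real.cos (α / 2 * (z + 1 / 2)) ≠ 0) (h4 : Real.cos (α / 2 * (z - 1 / 2)) ≠ 0) :
    c / (Real.sin (α / 2 * w) * Real.sin (α / 2 * (w + 1))) *
      (Real.cos (α / 2 * (z + 1 / 2 + w)) / Real.cos (α / 2 * (z + 1 / 2))) *
      (Real.cos (α / 2 * (z - 1 / 2 - w)) / Real.cos (α / 2 * (z - 1 / 2))) =
    c / (Real.sin (α / 2 * w) * Real.sin (α / 2 * (w + 1))) -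
      c / (Real.cos (α / 2 * (z + 1 / 2)) * Real.cos (α / 2 * (z - 1 / 2))) := by
  have key : Real.cos (α / 2 * (z + 1 / 2 + w)) * Real.cos (α / 2 * (z - 1 / 2 - w)) =
      Real.cos (α / 2 * (z + 1 / 2)) * Real.cos (α / 2 * (z - 1 / 2)) -
      Real.sin (α / 2 * w) * Real.sin (α / 2 * (w + 1)) := by
    have e1 := Real.two_mul_cos_mul_cos (α / 2 * (z + 1 / 2 + w)) (α / 2 * (z - 1 / 2 - w))
    have e2 := Real.two_mul_cos_mul_cos (α / 2 * (z + 1 / 2)) (α / 2 * (z - 1 / 2))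
    have e3 := Real.two_mul_sin_mul_sin (α / 2 * (w + 1)) (α / 2 * w)
    ring_nf at e1 e2 e3 ⊢
    linarith
  exact mul_ratio_eq_sub h1 h2 h3 h4 key

/-- A pole of the first or second summand can only be met when u₁ = 1/2 or u₂ = 1/2 respectively;
then c_r contains the factor [0]₁ = 0 for every p and the summand disappears. The third and fourth
ratios tend to 1. -/
lemma tendsto_coefB {α : ℝ} (hα : α ≠ 0) (u v : Fin 4 → ℝ) {w z : ℝ}
    (h1 : Real.sin (α / 2 * w) ≠ 0) (h2 : Real.sin (α / 2 * (w + 1)) ≠ 0)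
    (hs : u 0 = 1 / 2 ∨
      Real.sin (α / 2 * (z + 1 / 2)) ≠ 0 ∧ Real.sin (α / 2 * (z - 1 / 2)) ≠ 0)
    (hc : u 1 = 1 / 2 ∨
      Real.cos (α / 2 * (z + 1 / 2)) ≠ 0 ∧ Real.cos (α / 2 * (z - 1 / 2)) ≠ 0) :
    Tendsto (fun p => coefB α p u v w z) (𝓝[>] 0)
      (𝓝 (∑ r : Fin 4, trigC α u v w r + trigBeta α u v z)) := by
  have hα2 : α / 2 ≠ 0 := by simpa using hα
  have hC := tendsto_coefC hα u v h1 h2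
  have hratio : ∀ r, trigBracket α r (z + 1 / 2) ≠ 0 → trigBracket α r (z - 1 / 2) ≠ 0 →
      Tendsto (fun p => coefC α p u v w r *
        (bracket α p r (z + 1 / 2 + w) / bracket α p r (z + 1 / 2)) *
        (bracket α p r (z - 1 / 2 - w) / bracket α p r (z - 1 / 2))) (𝓝[>] 0)
      (𝓝 (trigC α u v w r * (trigBracket α r (z + 1 / 2 + w) / trigBracket α r (z + 1 / 2)) *
        (trigBracket α r (z - 1 / 2 - w) / trigBracket α r (z - 1 / 2)))) := fun r ha hb =>
    ((hC r).mul ((tendsto_bracket hα r _).div (tendsto_bracket hα r _) ha)).mul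
      ((tendsto_bracket hα r _).div (tendsto_bracket hα r _) hb)
  have hsum : ∑ r : Fin 4, trigC α u v w r + trigBeta α u v z =
      (trigC α u v w 0 - 2 * Real.sin (α / 2 * (u 0 - 1 / 2)) * Real.sin (α / 2 * v 0) *
        Real.cos (α / 2 * (u 1 - 1 / 2)) * Real.cos (α / 2 * v 1) /
        (Real.sin (α / 2 * (z + 1 / 2)) * Real.sin (α / 2 * (z - 1 / 2)))) +
      (trigC α u v w 1 - 2 * Real.sin (α / 2 * (u 1 - 1 / 2)) * Real.sin (α / 2 * v 1) *
        Real.cos (α / 2 * (u 0 - 1 / 2)) * Real.cos (α / 2 * v 0) /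
        (Real.cos (α / 2 * (z + 1 / 2)) * Real.cos (α / 2 * (z - 1 / 2)))) +
      trigC α u v w 2 + trigC α u v w 3 := by
    rw [Fin.sum_univ_four, trigBeta]
    ring
  rw [hsum]
  simp only [coefB, Fin.sum_univ_four]
  refine Tendsto.add (Tendsto.add (Tendsto.add ?_ ?_) ?_) ?_
  · rcases hs with hs | ⟨ha, hb⟩
    · have e : ∀ p, coefC α p u v w 0 = 0 := fun p => by
        rw [coefC, Finset.prod_eq_zero (Finset.mem_univ 0), mul_zero]
        simp [halfPeriodPerm, hs, bracket_zero_zero]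
      have e' : trigC α u v w 0 = 0 := by simp [trigC, halfPeriodPerm, hs]
      simp only [e, e', hs]
      simp
    · convert hratio 0 (div_ne_zero ha hα2) (div_ne_zero hb hα2) using 2
      simp only [trigBracket, Matrix.cons_val_zero, div_div_div_cancel_right₀ hα2]
      exact (sin_ratio_mul α w z _ h1 h2 ha hb).symm
  · have hπ : halfPeriodPerm 1 0 = 1 := rfl
    rcases hc with hc | ⟨ha, hb⟩
    · have e : ∀ p, coefC α p u v w 1 = 0 := fun p => by
        rw [coefC, Finset.prod_eq_zero (Finset.mem_univ 0), mul_zero]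
        simp [hπ, hc, bracket_zero_zero]
      have e' : trigC α u v w 1 = 0 := by simp [trigC, hπ, hc]
      simp only [e, e', hc]
      simp
    · convert hratio 1 ha hb using 2
      simp only [trigBracket, Matrix.cons_val_one]
      exact (cos_ratio_mul α w z _ h1 h2 ha hb).symm
  · simpa [trigBracket] using hratio 2 (by simp [trigBracket]) (by simp [trigBracket])
  · simpa [trigBracket] using hratio 3 (by simp [trigBracket]) (by simp [trigBracket])

/-! ### The three-term recurrence of the `q`-Racah polynomials -/

lemma qPoch_succ (z q : ℂ) (l : ℕ) : qPoch z q (l + 1) = qPoch z q l * (1 - z * q ^ l) := by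
  rw [qPoch, Finset.prod_range_succ, qPoch]

lemma qPoch_succ_left (z q : ℂ) (l : ℕ) :
    qPoch z q (l + 1) = (1 - z) * qPoch (z * q) q l := by
  rw [qPoch, Finset.prod_range_succ', pow_zero, mul_one, mul_comm, qPoch]
  congr 1
  refine Finset.prod_congr rfl fun i _ => ?_
  ring

@[simp] lemma qPoch_zero (z q : ℂ) : qPoch z q 0 = 1 := by simp [qPoch]

/-- The product `(Q⁻¹; q)_l (e Q q; q)_l`, which for `Q = q^k` and `e = a b` is the part of the
`l`-th term of the `q`-Racah polynomial `R_k` that depends on `k`. -/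
def degreeFactor (q e Q : ℂ) (l : ℕ) : ℂ := qPoch Q⁻¹ q l * qPoch (e * Q * q) q l

lemma degreeFactor_succ (q e Q : ℂ) (j : ℕ) : degreeFactor q e Q (j + 1) =
    degreeFactor q e Q j * ((1 - Q⁻¹ * q ^ j) * (1 - e * Q * q * q ^ j)) := by
  simp only [degreeFactor, qPoch_succ]
  ring

/-- Replacing Q by Qq moves both factorials by one index. After multiplication by 1 - eQq, every
degree shift becomes a polynomial multiple of the same quantity `degreeFactor q e Q j`. -/
lemma degreeFactor_mul_base {q : ℂ} (hq : q ≠ 0) (e Q : ℂ) (j : ℕ) :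
    (1 - e * Q * q) * degreeFactor q e (Q * q) (j + 1) = degreeFactor q e Q j *
      ((1 - (Q * q)⁻¹) * (1 - e * Q * q * q ^ j) * (1 - e * Q * q * q ^ (j + 1))) := by
  have h1 : (Q * q)⁻¹ * q = Q⁻¹ := by rw [mul_inv, inv_mul_cancel_right₀ hq]
  have h2 := qPoch_succ_left (e * Q * q) q (j + 1)
  rw [qPoch_succ, qPoch_succ] at h2
  have h3 : e * (Q * q) * q = e * Q * q * q := by ring
  rw [degreeFactor, degreeFactor, qPoch_succ_left (Q * q)⁻¹, h1, h3]
  linear_combination -(1 - (Q * q)⁻¹) * qPoch Q⁻¹ q j * h2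

lemma degreeFactor_div_base {q : ℂ} (hq : q ≠ 0) (e Q : ℂ) (j : ℕ) :
    (1 - Q⁻¹) * degreeFactor q e (Q / q) (j + 1) = degreeFactor q e Q j *
      ((1 - Q⁻¹ * q ^ j) * (1 - Q⁻¹ * q ^ (j + 1)) * (1 - e * Q)) := by
  have h1 : (Q / q)⁻¹ = Q⁻¹ * q := by rw [inv_div, div_eq_mul_inv, mul_comm]
  have h2 := qPoch_succ_left Q⁻¹ q (j + 1)
  rw [qPoch_succ, qPoch_succ] at h2
  have h3 : e * (Q / q) * q = e * Q := by field_simp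
  rw [degreeFactor, degreeFactor, h1, h3, qPoch_succ_left (e * Q)]
  linear_combination -(1 - e * Q) * qPoch (e * Q * q) q j * h2

/-- The denominator of the `l`-th term of the `q`-Racah polynomials. -/
def racahDenom (q a b c d : ℂ) (l : ℕ) : ℂ :=
  qPoch (a * q) q l * qPoch (b * d * q) q l * qPoch (c * q) q l * qPoch q q l

/-- The factor of the `l`-th term of the `q`-Racah polynomials that does not depend on the
spectral variable. -/
def racahCoeff (q a b c d Q : ℂ) (l : ℕ) : ℂ :=
  degreeFactor q (a * b) Q l * q ^ l / racahDenom q a b c d l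

/-- This compares coefficients of s_{j+1}, where s_l = (x;q)_l (y;q)_l and xy = cdq. Multiplication
by x + y - 1 - cdq sends s_l to q^{-l}(1-q^l)(1-cdq·q^l) s_l - q^{-l} s_{l+1}, which explains the
right-hand side. The condition `hC0` is separate because at Q = 1 the equation `hC` leaves C
undetermined if ab = 1, which happens for u₁ = 1/2. -/
lemma racahCoeff_recurrence {q a b c d Q A C : ℂ} (hq : q ≠ 0) (hQ : Q ≠ 0)
    (hA : A * (1 - a * b * Q ^ 2 * q) * (1 - a * b * Q ^ 2 * q ^ 2) =
      (1 - a * Q * q) * (1 - a * b * Q * q) * (1 - b * d * Q * q) * (1 - c * Q * q))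
    (hC : C * (1 - a * b * Q ^ 2) * (1 - a * b * Q ^ 2 * q) =
      q * (1 - Q) * (1 - b * Q) * (c - a * b * Q) * (d - a * Q))
    (hC0 : Q = 1 → C = 0) (hD : 1 - a * b * Q ^ 2 * q ≠ 0) (hE : 1 - a * b * Q * q ≠ 0)
    (j : ℕ) (hW : racahDenom q a b c d (j + 1) ≠ 0) :
    A * (racahCoeff q a b c d (Q * q) (j + 1) - racahCoeff q a b c d Q (j + 1)) +
      C * (racahCoeff q a b c d (Q / q) (j + 1) - racahCoeff q a b c d Q (j + 1)) =
    (q ^ (j + 1))⁻¹ * (1 - q ^ (j + 1)) * (1 - c * d * q * q ^ (j + 1)) *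
      racahCoeff q a b c d Q (j + 1) - (q ^ j)⁻¹ * racahCoeff q a b c d Q j := by
  have hJ : q ^ j ≠ 0 := pow_ne_zero j hq
  have hWs : racahDenom q a b c d (j + 1) = racahDenom q a b c d j *
      ((1 - a * q * q ^ j) * (1 - b * d * q * q ^ j) * (1 - c * q * q ^ j) *
        (1 - q * q ^ j)) := by
    simp only [racahDenom, qPoch_succ]
    ring
  have h0 := degreeFactor_succ q (a * b) Q j
  have h1 := degreeFactor_mul_base hq (a * b) Q j
  have h2 := degreeFactor_div_base hq (a * b) Q j
  -- For Q = 1 the factor (1;q)_j vanishes unless j = 0, and then 1 - q^j vanishes.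
  have hz : Q = 1 → degreeFactor q (a * b) Q j * (1 - q ^ j) = 0 := by
    rintro rfl
    cases j with
    | zero => simp
    | succ j => simp [degreeFactor, qPoch_succ_left]
  have hTj : racahCoeff q a b c d Q j = degreeFactor q (a * b) Q j * q ^ j *
      ((1 - a * q * q ^ j) * (1 - b * d * q * q ^ j) * (1 - c * q * q ^ j) *
        (1 - q * q ^ j)) / racahDenom q a b c d (j + 1) := by
    rw [hWs] at hW ⊢
    rw [racahCoeff, mul_div_mul_right _ _ (right_ne_zero_of_mul hW)]
  rw [hTj]
  simp only [racahCoeff, pow_succ q j] at *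
  generalize racahDenom q a b c d (j + 1) = w at *
  generalize degreeFactor q (a * b) (Q * q) (j + 1) = X1 at *
  generalize degreeFactor q (a * b) (Q / q) (j + 1) = X2 at *
  generalize degreeFactor q (a * b) Q (j + 1) = X0 at *
  generalize degreeFactor q (a * b) Q j = N at *
  generalize q ^ j = J at *
  have partA : A * (X1 - X0) * (1 - a * b * Q ^ 2 * q) =
      -(N * (1 - a * b * Q * q * J) * (1 - q * J) * (Q * q)⁻¹ *
        ((1 - a * Q * q) * (1 - b * d * Q * q) * (1 - c * Q * q))) := by
    apply mul_left_cancel₀ hE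
    have e : (1 - a * b * Q * q) * (X1 - X0) = -(N * (1 - a * b * Q * q * J) * (1 - q * J) *
        (Q * q)⁻¹ * (1 - a * b * Q ^ 2 * q ^ 2)) := by
      rw [mul_sub, h1, h0]
      field_simp
      ring
    linear_combination A * (1 - a * b * Q ^ 2 * q) * e -
      N * (1 - a * b * Q * q * J) * (1 - q * J) * (Q * q)⁻¹ * hA
  have partC : C * (X2 - X0) * (1 - a * b * Q ^ 2 * q) =
      -(N * (1 - Q⁻¹ * J) * (1 - q * J) * (q * (1 - b * Q) * (c - a * b * Q) * (d - a * Q))) := by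
    -- The lowering relation carries the factor 1 - Q⁻¹, which can be cancelled only for Q ≠ 1; at Q
    -- = 1 both sides are zero.
    by_cases h : Q = 1
    · have hz' := hz h
      rw [hC0 h, h]
      linear_combination (1 - q * J) * (q * (1 - b * 1) * (c - a * b * 1) * (d - a * 1)) * hz'
    · have hne : 1 - Q⁻¹ ≠ 0 := by
        intro h'
        apply h
        field_simp at h'
        linear_combination h'
      apply mul_left_cancel₀ hne
      have e : (1 - Q⁻¹) * (X2 - X0) = N * (1 - Q⁻¹ * J) * (1 - q * J) * Q⁻¹ *
          (1 - a * b * Q ^ 2) := by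
        rw [mul_sub, h2, h0]
        field_simp
        ring
      have e' : (1 - Q) * Q⁻¹ = -(1 - Q⁻¹) := by
        field_simp
        ring
      linear_combination C * (1 - a * b * Q ^ 2 * q) * e +
        N * (1 - Q⁻¹ * J) * (1 - q * J) * Q⁻¹ * hC +
        N * (1 - Q⁻¹ * J) * (1 - q * J) * (q * (1 - b * Q) * (c - a * b * Q) * (d - a * Q)) * e'
  have main : (A * (X1 - X0) + C * (X2 - X0)) * (J * q) =
      (1 - J * q) * (1 - c * d * q * (J * q)) * X0 - N *
        ((1 - a * q * J) * (1 - b * d * q * J) * (1 - c * q * J) * (1 - q * J)) := by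
    apply mul_left_cancel₀ hD
    have : (1 - a * b * Q ^ 2 * q) * ((A * (X1 - X0) + C * (X2 - X0)) * (J * q)) =
        (A * (X1 - X0) * (1 - a * b * Q ^ 2 * q) + C * (X2 - X0) * (1 - a * b * Q ^ 2 * q)) *
          (J * q) := by ring
    rw [this, partA, partC, h0]
    field_simp
    ring
  field_simp
  linear_combination main

/-- The product `(x; q)_l (y; q)_l`. -/
def spectralFactor (q x y : ℂ) (l : ℕ) : ℂ := qPoch x q l * qPoch y q l

/-- The `q`-Racah polynomial truncated after the term with index `M`. -/
def racahSum (q a b c d Q x y : ℂ) (M : ℕ) : ℂ :=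
  ∑ l ∈ Finset.range (M + 1), racahCoeff q a b c d Q l * spectralFactor q x y l

/-- Cutting the sum at M leaves exactly one boundary term, the s_{M+1} produced by multiplying the
last summand with the spectral variable. The other terms match by `racahCoeff_recurrence`. -/
lemma racahSum_recurrence_aux {q a b c d Q A C x y : ℂ} (hq : q ≠ 0) (hQ : Q ≠ 0)
    (hA : A * (1 - a * b * Q ^ 2 * q) * (1 - a * b * Q ^ 2 * q ^ 2) =
      (1 - a * Q * q) * (1 - a * b * Q * q) * (1 - b * d * Q * q) * (1 - c * Q * q))
    (hC : C * (1 - a * b * Q ^ 2) * (1 - a * b * Q ^ 2 * q) =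
      q * (1 - Q) * (1 - b * Q) * (c - a * b * Q) * (d - a * Q))
    (hC0 : Q = 1 → C = 0) (hD : 1 - a * b * Q ^ 2 * q ≠ 0) (hE : 1 - a * b * Q * q ≠ 0)
    (hxy : x * y = c * d * q)
    (M : ℕ) (hW : ∀ l ≤ M, racahDenom q a b c d l ≠ 0) :
    A * (racahSum q a b c d (Q * q) x y M - racahSum q a b c d Q x y M) +
      C * (racahSum q a b c d (Q / q) x y M - racahSum q a b c d Q x y M) =
    (x + y - 1 - c * d * q) * racahSum q a b c d Q x y M +
      (q ^ M)⁻¹ * racahCoeff q a b c d Q M * spectralFactor q x y (M + 1) := by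
  have hs : ∀ l, spectralFactor q x y (l + 1) =
      spectralFactor q x y l * ((1 - x * q ^ l) * (1 - y * q ^ l)) := by
    intro l
    simp only [spectralFactor, qPoch_succ]
    ring
  induction M with
  | zero =>
    simp only [racahSum, zero_add, Finset.sum_range_one, hs 0]
    simp [racahCoeff, degreeFactor, racahDenom, spectralFactor]
    linear_combination -hxy
  | succ M ih =>
    have ih := ih fun l hl => hW l (by omega)
    have hrec := racahCoeff_recurrence hq hQ hA hC hC0 hD hE M (hW (M + 1) le_rfl)
    have hsum : ∀ Q', racahSum q a b c d Q' x y (M + 1) = racahSum q a b c d Q' x y M +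
        racahCoeff q a b c d Q' (M + 1) * spectralFactor q x y (M + 1) := fun Q' => by
      rw [racahSum, Finset.sum_range_succ, racahSum]
    rw [hsum, hsum, hsum, hs (M + 1)]
    have hp : q ^ (M + 1) ≠ 0 := pow_ne_zero _ hq
    have e : (q ^ (M + 1))⁻¹ * ((1 - x * q ^ (M + 1)) * (1 - y * q ^ (M + 1))) =
        (q ^ (M + 1))⁻¹ * (1 - q ^ (M + 1)) * (1 - c * d * q * q ^ (M + 1)) -
          (x + y - 1 - c * d * q) := by
      rw [← hxy]
      field_simp
      ring
    linear_combination ih + spectralFactor q x y (M + 1) * hrec -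
      racahCoeff q a b c d Q (M + 1) * spectralFactor q x y (M + 1) * e

lemma racahSum_recurrence {q a b c d Q A C x y : ℂ} (hq : q ≠ 0) (hQ : Q ≠ 0)
    (hA : A * (1 - a * b * Q ^ 2 * q) * (1 - a * b * Q ^ 2 * q ^ 2) =
      (1 - a * Q * q) * (1 - a * b * Q * q) * (1 - b * d * Q * q) * (1 - c * Q * q))
    (hC : C * (1 - a * b * Q ^ 2) * (1 - a * b * Q ^ 2 * q) =
      q * (1 - Q) * (1 - b * Q) * (c - a * b * Q) * (d - a * Q))
    (hC0 : Q = 1 → C = 0) (hD : 1 - a * b * Q ^ 2 * q ≠ 0) (hE : 1 - a * b * Q * q ≠ 0)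
    (hxy : x * y = c * d * q)
    (M : ℕ) (hW : ∀ l ≤ M, racahDenom q a b c d l ≠ 0)
    (hend : racahCoeff q a b c d Q M * spectralFactor q x y (M + 1) = 0) :
    A * racahSum q a b c d (Q * q) x y M - (A + C) * racahSum q a b c d Q x y M +
      C * racahSum q a b c d (Q / q) x y M =
    (x + y - 1 - c * d * q) * racahSum q a b c d Q x y M := by
  have h := racahSum_recurrence_aux hq hQ hA hC hC0 hD hE hxy M hW
  rw [mul_assoc _ (racahCoeff q a b c d Q M), hend, mul_zero, add_zero] at h
  linear_combination h

lemma qPoch_eq_zero {z q : ℂ} {i l : ℕ} (hi : i < l) (h : z * q ^ i = 1) : qPoch z q l = 0 :=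
  Finset.prod_eq_zero (Finset.mem_range.2 hi) (by rw [h, sub_self])

lemma qPoch_ne_zero {z q : ℂ} {l : ℕ} (h : ∀ i < l, z * q ^ i ≠ 1) : qPoch z q l ≠ 0 :=
  Finset.prod_ne_zero_iff.2 fun i hi => sub_ne_zero.2 (h i (Finset.mem_range.1 hi)).symm

lemma racahCoeff_eq_zero {q : ℂ} (hq : q ≠ 0) (a b c d : ℂ) {k l : ℕ} (h : k < l) :
    racahCoeff q a b c d (q ^ k) l = 0 := by
  rw [racahCoeff, degreeFactor, qPoch_eq_zero h (inv_mul_cancel₀ (pow_ne_zero k hq))]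
  simp

/-- The factor (q^{-k};q)_l kills all terms with l > k, so one cutoff M serves all degrees up to M.
This is needed to compare neighbouring degrees in the recurrence. -/
lemma qRacah_eq_racahSum {q : ℂ} (hq : q ≠ 0) (a b c d x : ℂ) {k M : ℕ} (h : k ≤ M) :
    qRacah k x a b c d q =
      racahSum q a b c d (q ^ k) (q ^ (-x)) (c * d * q ^ (x + 1)) M := by
  have hk : q ^ (-(k : ℂ)) = (q ^ k)⁻¹ := by rw [Complex.cpow_neg, Complex.cpow_natCast]
  have hab : a * b * q ^ (k + 1) = a * b * q ^ k * q := by ring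
  have hterm : ∀ l, qPoch (q ^ (-(k : ℂ))) q l * qPoch (a * b * q ^ (k + 1)) q l *
      qPoch (q ^ (-x)) q l * qPoch (c * d * q ^ (x + 1)) q l /
      (qPoch (a * q) q l * qPoch (b * d * q) q l * qPoch (c * q) q l * qPoch q q l) * q ^ l =
      racahCoeff q a b c d (q ^ k) l *
        spectralFactor q (q ^ (-x)) (c * d * q ^ (x + 1)) l := by
    intro l
    rw [hk, hab, racahCoeff, degreeFactor, spectralFactor, racahDenom]
    ring
  rw [qRacah, phi43, racahSum]
  simp only [hterm]
  refine tsum_eq_sum fun l hl => ?_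
  rw [racahCoeff_eq_zero hq a b c d (by simp at hl; omega), zero_mul]

/-! ### Trigonometric identities for the limit coefficients -/

lemma sin_eq_exp_inv (x : ℂ) : Complex.sin x =
    (Complex.exp (x * Complex.I) - (Complex.exp (x * Complex.I))⁻¹) / (2 * Complex.I) := by
  rw [Complex.sin, neg_mul, Complex.exp_neg]
  field_simp
  rw [Complex.I_sq]
  ring

lemma cos_eq_exp_inv (x : ℂ) : Complex.cos x =
    (Complex.exp (x * Complex.I) + (Complex.exp (x * Complex.I))⁻¹) / 2 := by
  rw [Complex.cos, neg_mul, Complex.exp_neg]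

-- With denominators cleared, this says that A(z) + A(-z) + β(z) is constant. Conceptually, this
-- function is even and π-periodic in z, its poles cancel, and its value at z → i∞ is 2cos(a+b+c+d).
set_option maxRecDepth 20000 in
lemma trig_partial_fractions (z a b c d h : ℝ) :
    Real.sin (z + a) * Real.sin (z + h + c) * Real.cos (z + b) * Real.cos (z + h + d) *
        (Real.sin (z - h) * Real.cos (z - h)) +
      Real.sin (a - z) * Real.sin (h - z + c) * Real.cos (b - z) * Real.cos (h - z + d) *
        (Real.sin (z + h) * Real.cos (z + h)) -
      2 * Real.sin (a - h) * Real.sin c * Real.cos (b - h) * Real.cos d *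
        (Real.sin z * Real.cos z * Real.cos (z + h) * Real.cos (z - h)) -
      2 * Real.sin (b - h) * Real.sin d * Real.cos (a - h) * Real.cos c *
        (Real.sin z * Real.cos z * Real.sin (z + h) * Real.sin (z - h)) =
    2 * Real.cos (a + b + c + d) * (Real.sin z * Real.cos z *
      (Real.sin (z + h) * Real.cos (z + h)) * (Real.sin (z - h) * Real.cos (z - h))) := by
  -- This term has five sines and all others three. Turning two of them into cosines makes the
  -- powers of i agree, so that an identity of Laurent polynomials in exponentials remains.
  rw [Real.two_mul_sin_mul_sin (b - h)]
  apply Complex.ofReal_injective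
  push_cast
  simp only [sin_eq_exp_inv, cos_eq_exp_inv, add_mul, sub_mul, Complex.exp_add, Complex.exp_sub]
  have hz := Complex.exp_ne_zero (z * Complex.I)
  have ha := Complex.exp_ne_zero (a * Complex.I)
  have hb := Complex.exp_ne_zero (b * Complex.I)
  have hc := Complex.exp_ne_zero (c * Complex.I)
  have hd := Complex.exp_ne_zero (d * Complex.I)
  have hh := Complex.exp_ne_zero (h * Complex.I)
  have hI := Complex.I_ne_zero
  have hI2 := Complex.I_sq
  generalize Complex.exp (z * Complex.I) = Z at *
  generalize Complex.exp (a * Complex.I) = A at *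
  generalize Complex.exp (b * Complex.I) = B at *
  generalize Complex.exp (c * Complex.I) = C at *
  generalize Complex.exp (d * Complex.I) = D at *
  generalize Complex.exp (h * Complex.I) = H at *
  generalize Complex.I = I at *
  field_simp
  ring

lemma trigA_add_trigA_neg {α : ℝ} (u v : Fin 4 → ℝ) {z : ℝ}
    (h1 : Real.sin (α / 2 * z) ≠ 0) (h2 : Real.cos (α / 2 * z) ≠ 0)
    (h3 : Real.sin (α / 2 * (z + 1 / 2)) ≠ 0) (h4 : Real.cos (α / 2 * (z + 1 / 2)) ≠ 0)
    (h5 : Real.sin (α / 2 * (z - 1 / 2)) ≠ 0) (h6 : Real.cos (α / 2 * (z - 1 / 2)) ≠ 0) :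
    trigA α u v z + trigA α u v (-z) + trigBeta α u v z =
      2 * Real.cos (α / 2 * (u 0 + u 1 + v 0 + v 1)) := by
  have key := trig_partial_fractions (α / 2 * z) (α / 2 * u 0) (α / 2 * u 1) (α / 2 * v 0)
    (α / 2 * v 1) (α / 2 * (1 / 2))
  have e1 : α / 2 * (-z) = -(α / 2 * z) := by ring
  have e2 : α / 2 * (-z + 1 / 2) = -(α / 2 * (z - 1 / 2)) := by ring
  have e3 : α / 2 * (-z + u 0) = α / 2 * (u 0 - z) := by ring
  have e4 : α / 2 * (-z + u 1) = α / 2 * (u 1 - z) := by ring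
  have e5 : α / 2 * (-z + 1 / 2 + v 0) = α / 2 * (1 / 2 - z + v 0) := by ring
  have e6 : α / 2 * (-z + 1 / 2 + v 1) = α / 2 * (1 / 2 - z + v 1) := by ring
  simp only [← mul_add, ← mul_sub] at key
  simp only [trigA, trigBeta, e1, e2, e3, e4, e5, e6, Real.sin_neg, Real.cos_neg]
  generalize Real.cos (α / 2 * (u 0 + u 1 + v 0 + v 1)) = R at *
  generalize Real.sin (α / 2 * z) = sz at *
  generalize Real.cos (α / 2 * z) = cz at *
  generalize Real.sin (α / 2 * (z + 1 / 2)) = sp at *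
  generalize Real.cos (α / 2 * (z + 1 / 2)) = cp at *
  generalize Real.sin (α / 2 * (z - 1 / 2)) = sm at *
  generalize Real.cos (α / 2 * (z - 1 / 2)) = cm at *
  generalize Real.sin (α / 2 * (z + u 0)) = x1 at *
  generalize Real.sin (α / 2 * (z + 1 / 2 + v 0)) = x2 at *
  generalize Real.cos (α / 2 * (z + u 1)) = x3 at *
  generalize Real.cos (α / 2 * (z + 1 / 2 + v 1)) = x4 at *
  generalize Real.sin (α / 2 * (u 0 - z)) = y1 at *
  generalize Real.sin (α / 2 * (1 / 2 - z + v 0)) = y2 at *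
  generalize Real.cos (α / 2 * (u 1 - z)) = y3 at *
  generalize Real.cos (α / 2 * (1 / 2 - z + v 1)) = y4 at *
  generalize Real.sin (α / 2 * (u 0 - 1 / 2)) = t1 at *
  generalize Real.sin (α / 2 * v 0) = t2 at *
  generalize Real.cos (α / 2 * (u 1 - 1 / 2)) = t3 at *
  generalize Real.cos (α / 2 * v 1) = t4 at *
  generalize Real.sin (α / 2 * (u 1 - 1 / 2)) = t5 at *
  generalize Real.sin (α / 2 * v 1) = t6 at *
  generalize Real.cos (α / 2 * (u 0 - 1 / 2)) = t7 at *
  generalize Real.cos (α / 2 * v 0) = t8 at *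
  field_simp
  linear_combination key

/-- What remains of the partial fraction identity in a boundary row whose denominator vanishes; it
is used with h = α/4. -/
lemma cos_mul_cos_sub_sin_mul_sin (b d h : ℝ) :
    Real.cos (h + b) * Real.cos (2 * h + d) - Real.sin (b - h) * Real.sin d =
      Real.cos (2 * h) * Real.cos (b + d + h) := by
  have e1 := Real.two_mul_cos_mul_cos (h + b) (2 * h + d)
  have e2 := Real.two_mul_sin_mul_sin (b - h) d
  have e3 := Real.two_mul_cos_mul_cos (2 * h) (b + d + h)
  have e4 : Real.cos (h + b - (2 * h + d)) = Real.cos (b - h - d) := by congr 1; ring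
  have e5 : Real.cos (2 * h - (b + d + h)) = Real.cos (b - h + d) := by
    rw [← Real.cos_neg]; congr 1; ring
  have e6 : Real.cos (h + b + (2 * h + d)) = Real.cos (2 * h + (b + d + h)) := by
    congr 1; ring
  rw [e4, e6] at e1
  rw [e5] at e3
  linarith

/-- The degenerate case `z = u₁ = 1/2`, `v₁ = 0` of `trigA_add_trigA_neg`. -/
lemma trigA_add_trigA_neg_of_left {α : ℝ} (u v : Fin 4 → ℝ) (hu : u 0 = 1 / 2) (hv : v 0 = 0)
    (h1 : Real.sin (α / 2 * (1 / 2)) ≠ 0) (h2 : Real.cos (α / 2 * (1 / 2)) ≠ 0)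
    (h3 : Real.cos (α / 2) ≠ 0) :
    trigA α u v (u 0) + trigA α u v (-u 0) + trigBeta α u v (u 0) =
      2 * Real.cos (α / 2 * (u 0 + u 1 + v 0 + v 1)) := by
  have key := cos_mul_cos_sub_sin_mul_sin (α / 2 * u 1) (α / 2 * v 1) (α / 2 * (1 / 2))
  have hd := Real.sin_two_mul (α / 2 * (1 / 2))
  have e0 : 2 * (α / 2 * (1 / 2)) = α / 2 := by ring
  have e1 : α / 2 * (1 / 2) + α / 2 * u 1 = α / 2 * (1 / 2 + u 1) := by ring
  have e2 : α / 2 + α / 2 * v 1 = α / 2 * (1 + v 1) := by ring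
  have e3 : α / 2 * u 1 - α / 2 * (1 / 2) = α / 2 * (u 1 - 1 / 2) := by ring
  have e4 : α / 2 * u 1 + α / 2 * v 1 + α / 2 * (1 / 2) = α / 2 * (1 / 2 + u 1 + v 1) := by
    ring
  rw [e0] at hd
  rw [e0, e1, e2, e3, e4] at key
  have hh : (1 / 2 : ℝ) + 1 / 2 = 1 := by norm_num
  simp only [trigA, trigBeta, hu, hv, add_zero, sub_self, neg_add_cancel, mul_zero,
    Real.sin_zero, Real.cos_zero, zero_div, zero_mul, neg_zero, mul_one, hh]
  field_simp at h1 h2 h3 hd key ⊢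
  linear_combination 2 * Real.sin (α / 2 ^ 2) * Real.cos (α / 2 ^ 2) * key +
    Real.cos (α * (1 + 2 * u 1) / 2 ^ 2) * Real.cos (α * (1 + v 1) / 2) * hd

/-- The degenerate case `u₂ = 1/2`, `v₂ = 0` and `α (z + 1 / 2) = π` of
`trigA_add_trigA_neg`. -/
lemma trigA_add_trigA_neg_of_right {α z : ℝ} (u v : Fin 4 → ℝ) (hu : u 1 = 1 / 2)
    (hv : v 1 = 0) (hz : α / 2 * (z + 1 / 2) = Real.pi / 2)
    (h1 : Real.sin (α / 2 * (1 / 2)) ≠ 0) (h2 : Real.cos (α / 2 * (1 / 2)) ≠ 0)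
    (h3 : Real.cos (α / 2) ≠ 0) :
    trigA α u v z + trigA α u v (-z) + trigBeta α u v z =
      2 * Real.cos (α / 2 * (u 0 + u 1 + v 0 + v 1)) := by
  have key := cos_mul_cos_sub_sin_mul_sin (α / 2 * u 0) (α / 2 * v 0) (α / 2 * (1 / 2))
  have hd := Real.sin_two_mul (α / 2 * (1 / 2))
  have e0 : 2 * (α / 2 * (1 / 2)) = α / 2 := by ring
  have e1 : α / 2 * (1 / 2) + α / 2 * u 0 = α / 2 * (1 / 2 + u 0) := by ring
  have e2 : α / 2 + α / 2 * v 0 = α / 2 * (1 + v 0) := by ring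
  have e3 : α / 2 * u 0 - α / 2 * (1 / 2) = α / 2 * (u 0 - 1 / 2) := by ring
  have e4 : α / 2 * u 0 + α / 2 * v 0 + α / 2 * (1 / 2) = α / 2 * (u 0 + 1 / 2 + v 0) := by
    ring
  rw [e0] at hd
  rw [e0, e1, e2, e3, e4] at key
  -- Since αz/2 = π/2 - α/4, reflection exchanges sines and cosines and leads back to the identity
  -- of the other degenerate case with the indices 1 and 2 swapped.
  have hs : ∀ y, Real.sin (α / 2 * (-z + y)) = -Real.cos (α / 2 * (1 / 2 + y)) := fun y => by
    rw [← Real.sin_sub_pi_div_two, ← hz]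
    congr 1
    ring
  have hc : ∀ y, Real.cos (α / 2 * (-z + y)) = Real.sin (α / 2 * (1 / 2 + y)) := fun y => by
    rw [← Real.cos_sub_pi_div_two, ← hz]
    congr 1
    ring
  have hs0 : Real.sin (α / 2 * (-z)) = -Real.cos (α / 2 * (1 / 2)) := by simpa using hs 0
  have hc0 : Real.cos (α / 2 * (-z)) = Real.sin (α / 2 * (1 / 2)) := by simpa using hc 0
  have hh : (1 / 2 : ℝ) + 1 / 2 = 1 := by norm_num
  have f1 : -z + 1 / 2 + v 0 = -z + (1 / 2 + v 0) := by ring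
  have f2 : (1 / 2 : ℝ) + (1 / 2 + v 0) = 1 + v 0 := by ring
  have f3 : Real.sin (α / 2 * (z - 1 / 2)) = Real.cos (α / 2) := by
    rw [← Real.sin_pi_div_two_sub, ← hz]
    congr 1
    ring
  simp only [trigA, trigBeta, hu, hv, add_zero, sub_self, mul_zero, hz, f1, hs, hc, hs0, hc0, f2,
    f3, Real.sin_zero, Real.cos_zero, zero_div, zero_mul, mul_one, hh,
    Real.cos_pi_div_two, Real.sin_pi_div_two, zero_add, one_mul]
  field_simp at h1 h2 h3 hd key ⊢
  linear_combination 2 * Real.sin (α / 2 ^ 2) * Real.cos (α / 2 ^ 2) * key +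
    Real.cos (α * (1 + 2 * u 0) / 2 ^ 2) * Real.cos (α * (1 + v 0) / 2) * hd

/-! ### Determinants of tridiagonal matrices -/

/-- The leading principal `k × k` minor of an infinite matrix. -/
def leadingMinor {R : Type*} [CommRing R] (T : ℕ → ℕ → R) (k : ℕ) : R :=
  Matrix.det (Matrix.of fun i j : Fin k => T i j)

lemma leadingMinor_zero {R : Type*} [CommRing R] (T : ℕ → ℕ → R) : leadingMinor T 0 = 1 :=
  Matrix.det_fin_zero

lemma leadingMinor_one {R : Type*} [CommRing R] (T : ℕ → ℕ → R) :
    leadingMinor T 1 = T 0 0 := by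
  simp [leadingMinor]

/-- Expansion along the last row leaves two minors; the off-diagonal one is expanded along its last
column, where only one entry survives. -/
lemma leadingMinor_add_two {R : Type*} [CommRing R] (T : ℕ → ℕ → R)
    (h1 : ∀ i j, i + 1 < j → T i j = 0) (h2 : ∀ i j, j + 1 < i → T i j = 0) (k : ℕ) :
    leadingMinor T (k + 2) =
      T (k + 1) (k + 1) * leadingMinor T (k + 1) -
        T (k + 1) k * T k (k + 1) * leadingMinor T k := by
  have hsub : (Matrix.of fun i j : Fin (k + 2) => T i j).submatrix
      (Fin.last (k + 1)).succAbove (Fin.last (k + 1)).succAbove =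
      Matrix.of fun i j : Fin (k + 1) => T i j := by
    ext i j
    simp
  have hminor : ((Matrix.of fun i j : Fin (k + 2) => T i j).submatrix
      (Fin.last (k + 1)).succAbove (Fin.last k).castSucc.succAbove).det =
      T k (k + 1) * leadingMinor T k := by
    have hlast : (Fin.last k).castSucc.succAbove (Fin.last k) = Fin.last (k + 1) := by
      rw [Fin.succAbove_castSucc_self, Fin.succ_last]
    have hlt : ∀ j : Fin k, (Fin.last k).castSucc.succAbove j.castSucc =
        j.castSucc.castSucc := fun j => by
      rw [Fin.succAbove_of_castSucc_lt]
      exact Fin.castSucc_lt_castSucc_iff.2 (Fin.castSucc_lt_last j)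
    rw [Matrix.det_succ_column _ (Fin.last k), Fin.sum_univ_castSucc, Finset.sum_eq_zero, zero_add]
    · have : (((Matrix.of fun i j : Fin (k + 2) => T i j).submatrix
          (Fin.last (k + 1)).succAbove (Fin.last k).castSucc.succAbove).submatrix
          (Fin.last k).succAbove (Fin.last k).succAbove) =
          Matrix.of fun i j : Fin k => T i j := by
        ext i j
        simp [hlt]
      rw [this, leadingMinor]
      simp [hlast, ← two_mul]
    · intro i _
      simp only [Matrix.submatrix_apply, hlast, Matrix.of_apply, Fin.succAbove_last,
        Fin.val_last, Fin.val_castSucc]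
      rw [h1 _ _ (by omega)]
      simp
  rw [leadingMinor, Matrix.det_succ_row _ (Fin.last (k + 1)), Fin.sum_univ_castSucc,
    Fin.sum_univ_castSucc, hminor, hsub, Finset.sum_eq_zero, zero_add]
  · have hodd : (-1 : R) ^ (k + 1 + k) = -1 := Odd.neg_one_pow ⟨k, by ring⟩
    have heven : (-1 : R) ^ (k + 1 + (k + 1)) = 1 := Even.neg_one_pow ⟨k + 1, rfl⟩
    simp only [leadingMinor, Fin.val_last, Fin.val_castSucc, Matrix.of_apply, hodd, heven]
    ring
  · intro j _
    simp only [Matrix.of_apply, Fin.val_last, Fin.val_castSucc]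
    rw [h2 _ _ (by omega)]
    simp

/-- The leading principal minors of a tridiagonal matrix are determined by a solution of its
three-term recurrence. -/
lemma leadingMinor_eq_mul_prod {R : Type*} [CommRing R] (T : ℕ → ℕ → R)
    (h1 : ∀ i j, i + 1 < j → T i j = 0) (h2 : ∀ i j, j + 1 < i → T i j = 0)
    (F : ℕ → R) (N : ℕ) (hF0 : F 0 = 1)
    (hF1 : 0 < N → T 0 0 * F 0 + T 0 1 * F 1 = 0)
    (hF : ∀ k, k + 1 < N →
      T (k + 1) k * F k + T (k + 1) (k + 1) * F (k + 1) + T (k + 1) (k + 2) * F (k + 2) = 0)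
    {k : ℕ} (hk : k ≤ N) :
    leadingMinor T k = F k * ∏ j ∈ Finset.range k, (-T j (j + 1)) := by
  induction k using Nat.twoStepInduction with
  | zero => simp [leadingMinor_zero, hF0]
  | one =>
    have := hF1 (by omega)
    rw [hF0] at this
    simp only [leadingMinor_one, Finset.prod_range_one, zero_add]
    linear_combination this
  | more k ih1 ih2 =>
    rw [leadingMinor_add_two T h1 h2, ih1 (by omega), ih2 (by omega),
      Finset.prod_range_succ, Finset.prod_range_succ, Finset.prod_range_succ]
    linear_combination (-T k (k + 1) * ∏ j ∈ Finset.range k, (-T j (j + 1))) * hF k (by omega)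

/-! ### Perturbation of simple real roots -/

open Polynomial in
-- At e_j - δ and e_j + δ the limit polynomial has opposite signs: in the product of the two values,
-- the index j contributes -δ² and each i ≠ j contributes (e_j - e_i)² - δ² > 0. The sign change
-- persists near the limit, and the intermediate value theorem applies.
lemma exists_root_near {n : ℕ} {e : Fin n → ℝ} {δ : ℝ} (hδ : 0 < δ)
    (hgap : ∀ i j, i ≠ j → δ < |e i - e j|) {X : Type*} {l : Filter X} {χ : X → ℝ[X]}
    (hχ : ∀ t, Tendsto (fun p => (χ p).eval t) l (𝓝 (∏ i, (t - e i)))) (j : Fin n) :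
    ∀ᶠ p in l, ∃ r, |r - e j| ≤ δ ∧ (χ p).eval r = 0 := by
  have hneg : (∏ i, (e j - δ - e i)) * ∏ i, (e j + δ - e i) < 0 := by
    rw [← Finset.prod_mul_distrib, ← Finset.mul_prod_erase _ _ (Finset.mem_univ j)]
    refine mul_neg_of_neg_of_pos (by nlinarith) (Finset.prod_pos fun i hi => ?_)
    have h := hgap j i (Finset.ne_of_mem_erase hi).symm
    have h2 : δ ^ 2 < (e j - e i) ^ 2 := by
      rw [← sq_abs (e j - e i)]
      gcongr
    nlinarith
  filter_upwards [((hχ (e j - δ)).mul (hχ (e j + δ))).eventually_lt_const hneg] with p hp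
  have hmem : (0 : ℝ) ∈ Set.uIcc ((χ p).eval (e j - δ)) ((χ p).eval (e j + δ)) := by
    rw [Set.mem_uIcc]
    rcases mul_neg_iff.1 hp with h | h
    · exact Or.inr ⟨h.2.le, h.1.le⟩
    · exact Or.inl ⟨h.1.le, h.2.le⟩
  obtain ⟨r, hr, hr0⟩ := intermediate_value_uIcc (χ p).continuous.continuousOn hmem
  rw [Set.uIcc_of_le (by linarith), Set.mem_Icc] at hr
  exact ⟨r, abs_le.2 ⟨by linarith [hr.1], by linarith [hr.2]⟩, hr0⟩

open Polynomial in
lemma sort_roots_eq_ofFn {n : ℕ} {r : Fin n → ℝ} (hr : StrictAnti r) {P : ℝ[X]}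
    (hP : P.Monic) (hdeg : P.natDegree = n) (hroot : ∀ j, P.eval (r j) = 0) :
    P.roots.sort (· ≥ ·) = List.ofFn r := by
  have hnodup : (List.ofFn r).Nodup := List.nodup_ofFn.2 hr.injective
  have hle : (List.ofFn r : Multiset ℝ) ≤ P.roots := by
    rw [Multiset.le_iff_subset (Multiset.coe_nodup.2 hnodup)]
    intro x hx
    rw [Multiset.mem_coe, List.mem_ofFn] at hx
    obtain ⟨j, rfl⟩ := hx
    exact (mem_roots hP.ne_zero).2 (hroot j)
  have heq : (List.ofFn r : Multiset ℝ) = P.roots := by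
    refine Multiset.eq_of_le_of_card_le hle ?_
    simpa [hdeg] using P.card_roots'
  refine List.Perm.eq_of_sortedGE ?_ ?_ ?_
  · exact (Multiset.pairwise_sort _ _).sortedGE
  · exact hr.antitone.sortedGE_ofFn
  · rw [← Multiset.coe_eq_coe, Multiset.sort_eq, heq]

open Polynomial in
-- Around each e_j lies a root, and with δ at most half a lower bound for the gaps these roots keep
-- the order of the e_j. There are as many as the degree, so they are all the roots and the sorted
-- list is known.
lemma sort_roots_tendsto {n : ℕ} {e : Fin n → ℝ} (he : StrictAnti e) {X : Type*}
    {l : Filter X} {χ : X → ℝ[X]} (hmonic : ∀ p, (χ p).Monic) (hdeg : ∀ p, (χ p).natDegree = n)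
    (hχ : ∀ t, Tendsto (fun p => (χ p).eval t) l (𝓝 (∏ i, (t - e i)))) :
    (∀ᶠ p in l, ∃ r : Fin n → ℝ, StrictAnti r ∧ (∀ j, (χ p).eval (r j) = 0) ∧
      (χ p).roots.sort (· ≥ ·) = List.ofFn r) ∧
    ∀ j : Fin n, Tendsto (fun p => ((χ p).roots.sort (· ≥ ·)).getD j 0) l (𝓝 (e j)) := by
  obtain ⟨g, hg, hgap⟩ : ∃ g > 0, ∀ i j, i ≠ j → g < |e i - e j| := by
    have : ∀ᶠ g in 𝓝[>] (0 : ℝ), ∀ i j, i ≠ j → g < |e i - e j| := by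
      simp only [eventually_all]
      intro i j hij
      exact nhdsWithin_le_nhds (eventually_lt_nhds
        (abs_pos.2 (sub_ne_zero.2 (he.injective.ne hij))))
    obtain ⟨g, h1, h2⟩ := (this.and self_mem_nhdsWithin).exists
    exact ⟨g, h2, h1⟩
  have main : ∀ δ, 0 < δ → δ ≤ g / 2 → ∀ᶠ p in l, ∃ r : Fin n → ℝ, StrictAnti r ∧
      (∀ j, (χ p).eval (r j) = 0) ∧ (χ p).roots.sort (· ≥ ·) = List.ofFn r ∧
      ∀ j, |r j - e j| ≤ δ := by
    intro δ hδ hδg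
    have h := eventually_all.2 (exists_root_near hδ
      (fun i j hij => lt_of_le_of_lt (by linarith) (hgap i j hij)) hχ)
    filter_upwards [h] with p hp
    choose r hr hr0 using hp
    have hanti : StrictAnti r := fun i j hij => by
      have h1 := abs_le.1 (hr i)
      have h2 := abs_le.1 (hr j)
      have h3 := hgap i j hij.ne
      rw [abs_of_pos (sub_pos.2 (he hij))] at h3
      linarith [h1.1, h2.2]
    exact ⟨r, hanti, hr0, sort_roots_eq_ofFn hanti (hmonic p) (hdeg p) hr0, hr⟩
  refine ⟨?_, fun j => ?_⟩
  · filter_upwards [main (g / 2) (by linarith) le_rfl] with p ⟨r, h1, h2, h3, _⟩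
    exact ⟨r, h1, h2, h3⟩
  · rw [Metric.tendsto_nhds]
    intro ε hε
    filter_upwards [main (min (g / 2) (ε / 2)) (by positivity) (min_le_left _ _)] with
      p ⟨r, _, _, h3, h4⟩
    rw [h3, Real.dist_eq]
    have h5 := (h4 j).trans (min_le_right _ _)
    rw [List.getD_eq_getElem _ _ (by simp), List.getElem_ofFn]
    exact lt_of_le_of_lt h5 (by linarith)

/-! ### Non-vanishing of the trigonometric denominators -/

lemma scaling_pos {m : ℕ} {u : Fin 4 → ℝ} (h1 : 0 < u 0) (h2 : 0 < u 1) : 0 < scaling m u :=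
  div_pos Real.pi_pos (by positivity)

lemma scaling_half_mul {m : ℕ} {u : Fin 4 → ℝ} (h1 : 0 < u 0) (h2 : 0 < u 1) :
    scaling m u / 2 * (u 0 + u 1 + m) = Real.pi / 2 := by
  have : u 0 + u 1 + m ≠ 0 := by positivity
  rw [scaling]
  field_simp

lemma sin_scaling_pos {m : ℕ} {u : Fin 4 → ℝ} (h1 : 0 < u 0) (h2 : 0 < u 1) {y : ℝ}
    (hy : 0 < y) (hy' : y < 2 * (u 0 + u 1 + m)) : 0 < Real.sin (scaling m u / 2 * y) := by
  have hα := scaling_pos (m := m) h1 h2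
  have h := scaling_half_mul (m := m) h1 h2
  refine Real.sin_pos_of_pos_of_lt_pi (by positivity) ?_
  nlinarith

lemma sin_scaling_ne_zero {m : ℕ} {u : Fin 4 → ℝ} (h1 : 0 < u 0) (h2 : 0 < u 1) {y : ℝ}
    (hy : y ≠ 0) (hy' : |y| < 2 * (u 0 + u 1 + m)) : Real.sin (scaling m u / 2 * y) ≠ 0 := by
  rcases lt_or_gt_of_ne hy with h | h
  · rw [abs_of_neg h] at hy'
    have := sin_scaling_pos (m := m) h1 h2 (neg_pos.2 h) hy'
    rw [mul_neg, Real.sin_neg] at this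
    linarith
  · rw [abs_of_pos h] at hy'
    exact (sin_scaling_pos h1 h2 h hy').ne'

lemma cos_scaling_pos {m : ℕ} {u : Fin 4 → ℝ} (h1 : 0 < u 0) (h2 : 0 < u 1) {y : ℝ}
    (hy : |y| < u 0 + u 1 + m) : 0 < Real.cos (scaling m u / 2 * y) := by
  have hα := scaling_pos (m := m) h1 h2
  have h := scaling_half_mul (m := m) h1 h2
  obtain ⟨ha, hb⟩ := abs_lt.1 hy
  refine Real.cos_pos_of_mem_Ioo ⟨?_, ?_⟩ <;> nlinarith

/-- Shifted by π, this covers arguments in (π/2, 3π/2). It is needed in the last diagonal entry when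
u₂ < 1/2, as α(u₁+m+1/2)/2 then exceeds π/2. -/
lemma cos_scaling_ne_zero {m : ℕ} {u : Fin 4 → ℝ} (h1 : 0 < u 0) (h2 : 0 < u 1) {y : ℝ}
    (hy : |y - 2 * (u 0 + u 1 + m)| < u 0 + u 1 + m) :
    Real.cos (scaling m u / 2 * y) ≠ 0 := by
  have h := cos_scaling_pos h1 h2 hy
  have e : scaling m u / 2 * (y - 2 * (u 0 + u 1 + m)) = scaling m u / 2 * y - Real.pi := by
    linear_combination -2 * scaling_half_mul (m := m) h1 h2
  rw [e, Real.cos_sub_pi] at h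
  linarith

/-! ### Convergence of the matrix elements -/

/-- The limit of `heunEntry` for `p → 0`. -/
def trigEntry (m : ℕ) (u v : Fin 4 → ℝ) (w : ℝ) (i j : ℕ) : ℝ :=
  if i = j then ∑ r : Fin 4, trigC (scaling m u) u v w r + trigBeta (scaling m u) u v (u 0 + i)
  else if j = i + 1 then trigA (scaling m u) u v (u 0 + i)
  else if i = j + 1 then trigA (scaling m u) u v (-(u 0 + i))
  else 0

lemma upperCoef_sub {m : ℕ} (p : ℝ) (u v : Fin 4 → ℝ) {i : ℕ} (hi : i ≤ m) :
    upperCoef m p u v (m - i) = coefA (scaling m u) p u v (u 0 + i) := by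
  rw [upperCoef, Nat.cast_sub hi]
  congr 1
  ring

lemma tendsto_upperCoef {m : ℕ} {u : Fin 4 → ℝ} (h1 : 0 < u 0) (h2 : 0 < u 1)
    (v : Fin 4 → ℝ) {i : ℕ} (hi : i < m) :
    Tendsto (fun p => upperCoef m p u v (m - i)) (𝓝[>] 0)
      (𝓝 (trigA (scaling m u) u v (u 0 + i))) := by
  simp only [upperCoef_sub _ u v hi.le]
  have him : (i : ℝ) + 1 ≤ m := by exact_mod_cast hi
  have hi0 : (0 : ℝ) ≤ i := i.cast_nonneg
  refine tendsto_coefA (scaling_pos h1 h2).ne' u v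
    (sin_scaling_pos h1 h2 ?_ ?_).ne' (cos_scaling_pos h1 h2 (abs_lt.2 ⟨?_, ?_⟩)).ne'
    (sin_scaling_pos h1 h2 ?_ ?_).ne' (cos_scaling_pos h1 h2 (abs_lt.2 ⟨?_, ?_⟩)).ne' <;> linarith

lemma tendsto_lowerCoef {m : ℕ} {u : Fin 4 → ℝ} (h1 : 0 < u 0) (h2 : 0 < u 1)
    (v : Fin 4 → ℝ) {i : ℕ} (hi : 1 ≤ i) (him : i ≤ m) :
    Tendsto (fun p => lowerCoef m p u v i) (𝓝[>] 0)
      (𝓝 (trigA (scaling m u) u v (-(u 0 + i)))) := by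
  have e : -u 0 - (i : ℝ) = -(u 0 + i) := by ring
  simp only [lowerCoef, e]
  have hi' : (1 : ℝ) ≤ i := by exact_mod_cast hi
  have him' : (i : ℝ) ≤ m := by exact_mod_cast him
  refine tendsto_coefA (scaling_pos h1 h2).ne' u v
    (sin_scaling_ne_zero h1 h2 ?_ (abs_lt.2 ⟨?_, ?_⟩))
    (cos_scaling_pos h1 h2 (abs_lt.2 ⟨?_, ?_⟩)).ne'
    (sin_scaling_ne_zero h1 h2 ?_ (abs_lt.2 ⟨?_, ?_⟩))
    (cos_scaling_pos h1 h2 (abs_lt.2 ⟨?_, ?_⟩)).ne' <;>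
  linarith

lemma eq_zero_of_add_eq_half {x : ℝ} (hx : 0 < x) {k : ℕ} (h : x + k = 1 / 2) : k = 0 := by
  by_contra hk
  have : (1 : ℝ) ≤ k := by exact_mod_cast Nat.one_le_iff_ne_zero.2 hk
  linarith

lemma sin_scaling_sub_half_ne_zero {m : ℕ} (hm : 1 ≤ m) {u : Fin 4 → ℝ} (h1 : 0 < u 0)
    (h2 : 0 < u 1) {k : ℕ} (hk : k ≤ m) (h : ¬ (u 0 = 1 / 2 ∧ k = 0)) :
    Real.sin (scaling m u / 2 * (u 0 + k - 1 / 2)) ≠ 0 := by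
  have hk' : (k : ℝ) ≤ m := by exact_mod_cast hk
  have hm' : (1 : ℝ) ≤ m := by exact_mod_cast hm
  have hk0 : (0 : ℝ) ≤ k := k.cast_nonneg
  refine sin_scaling_ne_zero h1 h2 (fun h0 => h ?_) (abs_lt.2 ⟨?_, ?_⟩)
  · have hk := eq_zero_of_add_eq_half h1 (k := k) (by linarith)
    subst hk
    exact ⟨by simpa [sub_eq_zero] using h0, rfl⟩
  · linarith
  · linarith

lemma cos_scaling_add_half_ne_zero {m : ℕ} (hm : 1 ≤ m) {u : Fin 4 → ℝ} (h1 : 0 < u 0)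
    (h2 : 0 < u 1) {k : ℕ} (hk : k ≤ m) (h : ¬ (u 1 = 1 / 2 ∧ k = m)) :
    Real.cos (scaling m u / 2 * (u 0 + k + 1 / 2)) ≠ 0 := by
  have hk' : (k : ℝ) ≤ m := by exact_mod_cast hk
  have hm' : (1 : ℝ) ≤ m := by exact_mod_cast hm
  have hk0 : (0 : ℝ) ≤ k := k.cast_nonneg
  rcases lt_trichotomy (u 0 + k + 1 / 2) (u 0 + u 1 + m) with h' | h' | h'
  · exact (cos_scaling_pos h1 h2 (abs_lt.2 ⟨by linarith, h'⟩)).ne'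
  · exfalso
    have e : ((m - k : ℕ) : ℝ) = m - k := Nat.cast_sub hk
    have := eq_zero_of_add_eq_half h2 (k := m - k) (by rw [e]; linarith)
    refine h ⟨?_, by omega⟩
    rw [this] at e
    push_cast at e
    linarith
  · refine cos_scaling_ne_zero h1 h2 (abs_lt.2 ⟨?_, ?_⟩) <;> linarith

lemma tendsto_diagCoef {m : ℕ} (hm : 1 ≤ m) {u : Fin 4 → ℝ} (h1 : 0 < u 0) (h2 : 0 < u 1)
    (v : Fin 4 → ℝ) {w : ℝ}
    (hw : ∀ n : ℤ, w ≠ n * (2 * Real.pi / scaling m u) ∧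
      w + 1 ≠ n * (2 * Real.pi / scaling m u)) {k : ℕ} (hk : k ≤ m) :
    Tendsto (fun p => diagCoef m p u v w k) (𝓝[>] 0)
      (𝓝 (∑ r : Fin 4, trigC (scaling m u) u v w r +
        trigBeta (scaling m u) u v (u 0 + k))) := by
  have hα := scaling_pos (m := m) h1 h2
  have hk' : (k : ℝ) ≤ m := by exact_mod_cast hk
  have hm' : (1 : ℝ) ≤ m := by exact_mod_cast hm
  have hk0 : (0 : ℝ) ≤ k := k.cast_nonneg
  have hsin : ∀ y, (∀ n : ℤ, y ≠ n * (2 * Real.pi / scaling m u)) →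
      Real.sin (scaling m u / 2 * y) ≠ 0 := by
    intro y hy h
    obtain ⟨n, hn⟩ := Real.sin_eq_zero_iff.1 h
    apply hy n
    field_simp
    linear_combination -2 * hn
  refine tendsto_coefB hα.ne' u v (hsin w fun n => (hw n).1) (hsin _ fun n => (hw n).2) ?_ ?_
  · by_cases h : u 0 = 1 / 2
    · exact Or.inl h
    · exact Or.inr ⟨(sin_scaling_pos h1 h2 (by linarith) (by linarith)).ne',
        sin_scaling_sub_half_ne_zero hm h1 h2 hk fun h' => h h'.1⟩
  · by_cases h : u 1 = 1 / 2
    · exact Or.inl h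
    · exact Or.inr ⟨cos_scaling_add_half_ne_zero hm h1 h2 hk fun h' => h h'.1,
        (cos_scaling_pos h1 h2 (abs_lt.2 ⟨by linarith, by linarith⟩)).ne'⟩

lemma tendsto_heunEntry {m : ℕ} (hm : 1 ≤ m) {u : Fin 4 → ℝ} (h1 : 0 < u 0) (h2 : 0 < u 1)
    (v : Fin 4 → ℝ) {w : ℝ}
    (hw : ∀ n : ℤ, w ≠ n * (2 * Real.pi / scaling m u) ∧
      w + 1 ≠ n * (2 * Real.pi / scaling m u)) {i j : ℕ} (hi : i ≤ m) (hj : j ≤ m) :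
    Tendsto (fun p => heunEntry m p u v w i j) (𝓝[>] 0) (𝓝 (trigEntry m u v w i j)) := by
  unfold heunEntry trigEntry
  split_ifs with ha hb hc
  · exact tendsto_diagCoef hm h1 h2 v hw hi
  · exact tendsto_upperCoef h1 h2 v (by omega)
  · exact tendsto_lowerCoef h1 h2 v (by omega) hi
  · exact tendsto_const_nhds

/-! ### Properties of the limit coefficients -/

lemma trigA_add_trigA_neg_eq {m : ℕ} (hm : 1 ≤ m) {u v : Fin 4 → ℝ} (h1 : 0 < u 0)
    (h2 : 0 < u 1) (hs1 : u 0 = 1 / 2 → v 0 = 0) (hs2 : u 1 = 1 / 2 → v 1 = 0)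
    {k : ℕ} (hk : k ≤ m) :
    trigA (scaling m u) u v (u 0 + k) + trigA (scaling m u) u v (-(u 0 + k)) +
      trigBeta (scaling m u) u v (u 0 + k) =
    2 * Real.cos (scaling m u / 2 * (u 0 + u 1 + v 0 + v 1)) := by
  have hk' : (k : ℝ) ≤ m := by exact_mod_cast hk
  have hm' : (1 : ℝ) ≤ m := by exact_mod_cast hm
  have hk0 : (0 : ℝ) ≤ k := k.cast_nonneg
  have ha : Real.sin (scaling m u / 2 * (1 / 2)) ≠ 0 :=
    (sin_scaling_pos h1 h2 (by norm_num) (by linarith)).ne'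
  have hb : Real.cos (scaling m u / 2 * (1 / 2)) ≠ 0 :=
    (cos_scaling_pos h1 h2 (abs_lt.2 ⟨by linarith, by linarith⟩)).ne'
  have hc : Real.cos (scaling m u / 2) ≠ 0 := by
    have := (cos_scaling_pos (m := m) h1 h2 (y := 1) (abs_lt.2 ⟨by linarith, by linarith⟩)).ne'
    rwa [mul_one] at this
  by_cases hl : u 0 = 1 / 2 ∧ k = 0
  · obtain ⟨hu, rfl⟩ := hl
    rw [Nat.cast_zero, add_zero]
    exact trigA_add_trigA_neg_of_left u v hu (hs1 hu) ha hb hc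
  by_cases hr : u 1 = 1 / 2 ∧ k = m
  · obtain ⟨hu, rfl⟩ := hr
    refine trigA_add_trigA_neg_of_right u v hu (hs2 hu) ?_ ha hb hc
    rw [← scaling_half_mul h1 h2 (m := k), hu]
    ring
  exact trigA_add_trigA_neg u v
    (sin_scaling_pos h1 h2 (by linarith) (by linarith)).ne'
    (cos_scaling_pos h1 h2 (abs_lt.2 ⟨by linarith, by linarith⟩)).ne'
    (sin_scaling_pos h1 h2 (by linarith) (by linarith)).ne'
    (cos_scaling_add_half_ne_zero hm h1 h2 hk hr)
    (sin_scaling_sub_half_ne_zero hm h1 h2 hk hl)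
    (cos_scaling_pos h1 h2 (abs_lt.2 ⟨by linarith, by linarith⟩)).ne'

lemma trigA_mul_denom {m : ℕ} {u : Fin 4 → ℝ} (v : Fin 4 → ℝ) (h1 : 0 < u 0)
    (h2 : 0 < u 1) {k : ℕ} (hk : k ≤ m) :
    trigA (scaling m u) u v (u 0 + k) *
      (Real.sin (scaling m u / 2 * (u 0 + k)) * Real.cos (scaling m u / 2 * (u 0 + k)) *
        (Real.sin (scaling m u / 2 * (u 0 + k + 1 / 2)) *
          Real.cos (scaling m u / 2 * (u 0 + k + 1 / 2)))) =
    Real.sin (scaling m u / 2 * (u 0 + k + u 0)) *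
      Real.sin (scaling m u / 2 * (u 0 + k + 1 / 2 + v 0)) *
      (Real.cos (scaling m u / 2 * (u 0 + k + u 1)) *
        Real.cos (scaling m u / 2 * (u 0 + k + 1 / 2 + v 1))) := by
  -- For k = m a denominator vanishes if u₂ = 1/2, but the factor cos(α(u₁+m+u₂)/2) = cos(π/2) makes
  -- both sides zero.
  rcases hk.eq_or_lt with rfl | hk
  · have : Real.cos (scaling k u / 2 * (u 0 + k + u 1)) = 0 := by
      rw [← Real.cos_pi_div_two, ← scaling_half_mul h1 h2 (m := k)]
      congr 1
      ring
    simp [trigA, this]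
  · have hk' : (k : ℝ) + 1 ≤ m := by exact_mod_cast hk
    have hk0 : (0 : ℝ) ≤ k := k.cast_nonneg
    have e1 := (sin_scaling_pos (m := m) h1 h2 (y := u 0 + k) (by linarith) (by linarith)).ne'
    have e2 := (cos_scaling_pos (m := m) h1 h2 (y := u 0 + k)
      (abs_lt.2 ⟨by linarith, by linarith⟩)).ne'
    have e3 := (sin_scaling_pos (m := m) h1 h2 (y := u 0 + k + 1 / 2)
      (by linarith) (by linarith)).ne'
    have e4 := (cos_scaling_pos (m := m) h1 h2 (y := u 0 + k + 1 / 2)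
      (abs_lt.2 ⟨by linarith, by linarith⟩)).ne'
    rw [trigA, div_mul_div_comm, div_mul_div_comm, div_mul_div_comm, div_mul_eq_mul_div,
      div_eq_iff (by positivity)]
    ring

lemma trigA_neg_mul_denom {m : ℕ} {u : Fin 4 → ℝ} (v : Fin 4 → ℝ) (h1 : 0 < u 0)
    (h2 : 0 < u 1) {k : ℕ} (hk : k ≤ m) :
    trigA (scaling m u) u v (-(u 0 + k)) *
      (Real.sin (scaling m u / 2 * (u 0 + k)) * Real.cos (scaling m u / 2 * (u 0 + k)) *
        (Real.sin (scaling m u / 2 * (u 0 + k - 1 / 2)) *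
          Real.cos (scaling m u / 2 * (u 0 + k - 1 / 2)))) =
    Real.sin (scaling m u / 2 * k) *
      Real.sin (scaling m u / 2 * (u 0 + k - 1 / 2 - v 0)) *
      (Real.cos (scaling m u / 2 * (u 0 + k - u 1)) *
        Real.cos (scaling m u / 2 * (u 0 + k - 1 / 2 - v 1))) := by
  have hneg : ∀ {x y : ℝ}, x = -y →
      scaling m u / 2 * x = -(scaling m u / 2 * y) := by
    rintro x y rfl
    ring
  rw [trigA, hneg (x := -(u 0 + k) + u 0) (y := k) (by ring),
    hneg (x := -(u 0 + k)) rfl,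
    hneg (x := -(u 0 + k) + 1 / 2 + v 0) (y := u 0 + k - 1 / 2 - v 0) (by ring),
    hneg (x := -(u 0 + k) + 1 / 2) (y := u 0 + k - 1 / 2) (by ring),
    hneg (x := -(u 0 + k) + u 1) (y := u 0 + k - u 1) (by ring),
    hneg (x := -(u 0 + k) + 1 / 2 + v 1) (y := u 0 + k - 1 / 2 - v 1) (by ring)]
  simp only [Real.sin_neg, Real.cos_neg, neg_div_neg_eq]
  rcases Nat.eq_zero_or_pos k with rfl | hk1
  · simp
  · have hk' : (k : ℝ) ≤ m := by exact_mod_cast hk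
    have hk0 : (1 : ℝ) ≤ k := by exact_mod_cast hk1
    have e1 := (sin_scaling_pos (m := m) h1 h2 (y := u 0 + k) (by linarith) (by linarith)).ne'
    have e2 := (cos_scaling_pos (m := m) h1 h2 (y := u 0 + k)
      (abs_lt.2 ⟨by linarith, by linarith⟩)).ne'
    have e3 := (sin_scaling_pos (m := m) h1 h2 (y := u 0 + k - 1 / 2)
      (by linarith) (by linarith)).ne'
    have e4 := (cos_scaling_pos (m := m) h1 h2 (y := u 0 + k - 1 / 2)
      (abs_lt.2 ⟨by linarith, by linarith⟩)).ne'
    rw [div_mul_div_comm, div_mul_div_comm, div_mul_div_comm, div_mul_eq_mul_div,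
      div_eq_iff (by positivity)]
    ring

/-- The bounds on v₁ and v₂ keep the two sines and two cosines of the numerator positive. -/
lemma trigA_ne_zero {m : ℕ} {u v : Fin 4 → ℝ} (h1 : 0 < u 0) (h2 : 0 < u 1)
    (hv1 : |v 0| < u 0 + 1 / 2) (hv2 : |v 1| < u 1 + 1 / 2) {k : ℕ} (hk : k < m) :
    trigA (scaling m u) u v (u 0 + k) ≠ 0 := by
  have h := trigA_mul_denom v h1 h2 hk.le
  obtain ⟨a1, a2⟩ := abs_lt.1 hv1
  obtain ⟨b1, b2⟩ := abs_lt.1 hv2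
  have hk' : (k : ℝ) + 1 ≤ m := by exact_mod_cast hk
  have hk0 : (0 : ℝ) ≤ k := k.cast_nonneg
  intro h0
  rw [h0, zero_mul] at h
  have e1 := sin_scaling_pos (m := m) h1 h2 (y := u 0 + k + u 0) (by linarith) (by linarith)
  have e2 := sin_scaling_pos (m := m) h1 h2 (y := u 0 + k + 1 / 2 + v 0)
    (by linarith) (by linarith)
  have e3 := cos_scaling_pos (m := m) h1 h2 (y := u 0 + k + u 1)
    (abs_lt.2 ⟨by linarith, by linarith⟩)
  have e4 := cos_scaling_pos (m := m) h1 h2 (y := u 0 + k + 1 / 2 + v 1)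
    (abs_lt.2 ⟨by linarith, by linarith⟩)
  have : (0 : ℝ) < 0 := by
    conv_rhs => rw [h]
    positivity
  exact lt_irrefl _ this

lemma trigA_neg_zero (α : ℝ) (u v : Fin 4 → ℝ) : trigA α u v (-u 0) = 0 := by
  simp [trigA]

lemma trigA_last {m : ℕ} {u : Fin 4 → ℝ} (v : Fin 4 → ℝ) (h1 : 0 < u 0) (h2 : 0 < u 1) :
    trigA (scaling m u) u v (u 0 + m) = 0 := by
  have : Real.cos (scaling m u / 2 * (u 0 + m + u 1)) = 0 := by
    rw [← Real.cos_pi_div_two, ← scaling_half_mul h1 h2 (m := m)]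
    congr 1
    ring
  simp [trigA, this]

/-! ### The limit coefficients in exponential form -/

/-- `q^y` for `q = e^{iα}`. -/
def qExp (α : ℝ) (y : ℂ) : ℂ := Complex.exp (Complex.I * α * y)

lemma qExp_add (α : ℝ) (x y : ℂ) : qExp α (x + y) = qExp α x * qExp α y := by
  rw [qExp, mul_add, Complex.exp_add, qExp, qExp]

lemma qExp_zero (α : ℝ) : qExp α 0 = 1 := by simp [qExp]

lemma qExp_ne_zero (α : ℝ) (x : ℂ) : qExp α x ≠ 0 := Complex.exp_ne_zero _

lemma qExp_one_pow (α : ℝ) (k : ℕ) : qExp α 1 ^ k = qExp α k := by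
  rw [qExp, ← Complex.exp_nat_mul, qExp]
  congr 1
  ring

/-- For 0 < α < π the principal logarithm of e^{iα} is iα. -/
lemma cpow_eq_qExp {α : ℝ} (h0 : 0 < α) (h1 : α < Real.pi) (y : ℂ) :
    Complex.exp (Complex.I * α) ^ y = qExp α y := by
  rw [Complex.cpow_def_of_ne_zero (Complex.exp_ne_zero _), Complex.log_exp, qExp]
  · simp
    linarith [Real.pi_pos]
  · simpa using h1.le

lemma qExp_half_mul_self (α : ℝ) (y : ℂ) : qExp α y = qExp α (y / 2) * qExp α (y / 2) := by
  rw [← qExp_add, add_halves]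

lemma exp_half_angle (α : ℝ) (y : ℂ) : Complex.exp (α / 2 * y * Complex.I) = qExp α (y / 2) := by
  rw [qExp]
  congr 1
  ring

lemma one_sub_qExp (α : ℝ) (y : ℂ) :
    1 - qExp α y = -2 * Complex.I * qExp α (y / 2) * Complex.sin (α / 2 * y) := by
  rw [sin_eq_exp_inv, exp_half_angle, qExp_half_mul_self]
  have := qExp_ne_zero α (y / 2)
  field_simp
  ring

lemma one_add_qExp (α : ℝ) (y : ℂ) :
    1 + qExp α y = 2 * qExp α (y / 2) * Complex.cos (α / 2 * y) := by
  rw [cos_eq_exp_inv, exp_half_angle, qExp_half_mul_self]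
  have := qExp_ne_zero α (y / 2)
  field_simp
  ring

lemma one_sub_qExp_two_mul (α : ℝ) (y : ℂ) : 1 - qExp α (2 * y) =
    -4 * Complex.I * qExp α y * (Complex.sin (α / 2 * y) * Complex.cos (α / 2 * y)) := by
  have h : (α : ℂ) / 2 * (2 * y) = 2 * (α / 2 * y) := by ring
  rw [one_sub_qExp, h, Complex.sin_two_mul, mul_div_cancel_left₀ y two_ne_zero]
  ring

/-- The parameter `a` of the limiting `q`-Racah polynomials. -/
def parA (α : ℝ) (u : Fin 4 → ℝ) : ℂ := -qExp α (u 0 + u 1 - 1)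

/-- The parameter `b` of the limiting `q`-Racah polynomials. -/
def parB (α : ℝ) (u : Fin 4 → ℝ) : ℂ := -qExp α (u 0 - u 1)

/-- The parameter `c` of the limiting `q`-Racah polynomials. -/
def parC (α : ℝ) (u v : Fin 4 → ℝ) : ℂ := -qExp α (u 0 + v 1 - 1 / 2)

/-- The parameter `d` of the limiting `q`-Racah polynomials. -/
def parD (α : ℝ) (u v : Fin 4 → ℝ) : ℂ := -qExp α (u 1 + v 0 - 1 / 2)

/-- Each factor 1 ∓ q^y is a sine or cosine times a half power of q. The half powers combine to
q^{(u₁+u₂+v₁+v₂)/2}, a square root of cdq. The relation is kept free of division so that it also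
holds at k = m. -/
lemma racah_upper_coefficient {m : ℕ} {u : Fin 4 → ℝ} (v : Fin 4 → ℝ) (h1 : 0 < u 0)
    (h2 : 0 < u 1) {k : ℕ} (hk : k ≤ m) {α : ℝ} (hα : α = scaling m u) {q Q a b c d : ℂ}
    (hq : q = qExp α 1) (hQ : Q = qExp α k) (ha : a = parA α u) (hb : b = parB α u)
    (hc : c = parC α u v) (hd : d = parD α u v) :
    qExp α ((u 0 + u 1 + v 0 + v 1) / 2) * trigA α u v (u 0 + k) *
        (1 - a * b * Q ^ 2 * q) * (1 - a * b * Q ^ 2 * q ^ 2) =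
      (1 - a * Q * q) * (1 - a * b * Q * q) * (1 - b * d * Q * q) * (1 - c * Q * q) := by
  have key := congrArg ((↑) : ℝ → ℂ) (trigA_mul_denom v h1 h2 hk)
  rw [← hα] at key
  push_cast at key
  have e1 : a * b * Q ^ 2 * q = qExp α (2 * (u 0 + k)) := by
    simp only [ha, hb, hQ, hq, parA, parB, neg_mul, mul_neg, neg_neg, pow_two, ← qExp_add]
    ring_nf
  have e2 : a * b * Q ^ 2 * q ^ 2 = qExp α (2 * (u 0 + k + 1 / 2)) := by
    simp only [ha, hb, hQ, hq, parA, parB, neg_mul, mul_neg, neg_neg, pow_two, ← qExp_add]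
    ring_nf
  have e3 : a * Q * q = -qExp α (u 0 + k + u 1) := by
    simp only [ha, hQ, hq, parA, neg_mul, ← qExp_add]
    ring_nf
  have e4 : a * b * Q * q = qExp α (u 0 + k + u 0) := by
    simp only [ha, hb, hQ, hq, parA, parB, neg_mul, mul_neg, neg_neg, ← qExp_add]
    ring_nf
  have e5 : b * d * Q * q = qExp α (u 0 + k + 1 / 2 + v 0) := by
    simp only [hb, hd, hQ, hq, parB, parD, neg_mul, mul_neg, neg_neg, ← qExp_add]
    ring_nf
  have e6 : c * Q * q = -qExp α (u 0 + k + 1 / 2 + v 1) := by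
    simp only [hc, hQ, hq, parC, neg_mul, ← qExp_add]
    ring_nf
  have hexp : qExp α ((u 0 + u 1 + v 0 + v 1) / 2) * qExp α (u 0 + k) *
      qExp α (u 0 + k + 1 / 2) = qExp α ((u 0 + k + u 1) / 2) * qExp α ((u 0 + k + u 0) / 2) *
      qExp α ((u 0 + k + 1 / 2 + v 0) / 2) * qExp α ((u 0 + k + 1 / 2 + v 1) / 2) := by
    simp only [← qExp_add]
    ring_nf
  rw [e1, e2, e3, e4, e5, e6, sub_neg_eq_add, sub_neg_eq_add, one_sub_qExp_two_mul,
    one_sub_qExp_two_mul, one_sub_qExp, one_sub_qExp, one_add_qExp, one_add_qExp]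
  linear_combination (16 * Complex.I ^ 2 * qExp α ((u 0 + u 1 + v 0 + v 1) / 2) *
    qExp α (u 0 + k) * qExp α (u 0 + k + 1 / 2)) * key +
    16 * Complex.I ^ 2 * (Complex.sin (α / 2 * (u 0 + k + u 0)) *
      Complex.sin (α / 2 * (u 0 + k + 1 / 2 + v 0)) *
      (Complex.cos (α / 2 * (u 0 + k + u 1)) *
        Complex.cos (α / 2 * (u 0 + k + 1 / 2 + v 1)))) * hexp

lemma racah_lower_coefficient {m : ℕ} {u : Fin 4 → ℝ} (v : Fin 4 → ℝ) (h1 : 0 < u 0)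
    (h2 : 0 < u 1) {k : ℕ} (hk : k ≤ m) {α : ℝ} (hα : α = scaling m u) {q Q a b c d : ℂ}
    (hq : q = qExp α 1) (hQ : Q = qExp α k) (ha : a = parA α u) (hb : b = parB α u)
    (hc : c = parC α u v) (hd : d = parD α u v) :
    qExp α ((u 0 + u 1 + v 0 + v 1) / 2) * trigA α u v (-(u 0 + k)) *
        (1 - a * b * Q ^ 2) * (1 - a * b * Q ^ 2 * q) =
      q * (1 - Q) * (1 - b * Q) * (c - a * b * Q) * (d - a * Q) := by
  have key := congrArg ((↑) : ℝ → ℂ) (trigA_neg_mul_denom v h1 h2 hk)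
  rw [← hα] at key
  push_cast at key
  have e1 : a * b * Q ^ 2 * q = qExp α (2 * (u 0 + k)) := by
    simp only [ha, hb, hQ, hq, parA, parB, neg_mul, mul_neg, neg_neg, pow_two, ← qExp_add]
    ring_nf
  have e2 : a * b * Q ^ 2 = qExp α (2 * (u 0 + k - 1 / 2)) := by
    simp only [ha, hb, hQ, parA, parB, neg_mul, mul_neg, neg_neg, pow_two, ← qExp_add]
    ring_nf
  have e3 : b * Q = -qExp α (u 0 + k - u 1) := by
    simp only [hb, hQ, parB, neg_mul, ← qExp_add]
    ring_nf
  have e4 : c - a * b * Q = c * (1 + qExp α (u 0 + k - 1 / 2 - v 1)) := by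
    simp only [ha, hb, hc, hQ, parA, parB, parC, neg_mul, mul_neg, neg_neg, mul_add, mul_one,
      ← qExp_add]
    ring_nf
  have e5 : d - a * Q = d * (1 - qExp α (u 0 + k - 1 / 2 - v 0)) := by
    simp only [ha, hd, hQ, parA, parD, neg_mul, mul_sub, mul_one, ← qExp_add]
    ring_nf
  have hexp : qExp α ((u 0 + u 1 + v 0 + v 1) / 2) * qExp α (u 0 + k) *
      qExp α (u 0 + k - 1 / 2) = q * qExp α (k / 2) * qExp α ((u 0 + k - u 1) / 2) *
      (c * qExp α ((u 0 + k - 1 / 2 - v 1) / 2)) *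
      (d * qExp α ((u 0 + k - 1 / 2 - v 0) / 2)) := by
    simp only [hq, hc, hd, parC, parD, neg_mul, mul_neg, neg_neg, ← qExp_add]
    ring_nf
  rw [e1, e2, e3, e4, e5, sub_neg_eq_add, hQ, one_sub_qExp_two_mul,
    one_sub_qExp_two_mul, one_sub_qExp, one_sub_qExp, one_add_qExp, one_add_qExp]
  linear_combination (16 * Complex.I ^ 2 * qExp α ((u 0 + u 1 + v 0 + v 1) / 2) *
    qExp α (u 0 + k) * qExp α (u 0 + k - 1 / 2)) * key +
    16 * Complex.I ^ 2 * (Complex.sin (α / 2 * k) *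
      Complex.sin (α / 2 * (u 0 + k - 1 / 2 - v 0)) *
      (Complex.cos (α / 2 * (u 0 + k - u 1)) *
        Complex.cos (α / 2 * (u 0 + k - 1 / 2 - v 1)))) * hexp

lemma qExp_ne_one {m : ℕ} {u : Fin 4 → ℝ} (h1 : 0 < u 0) (h2 : 0 < u 1) {y : ℝ}
    (hy : 0 < y) (hy' : y < 2 * (u 0 + u 1 + m)) : qExp (scaling m u) y ≠ 1 := by
  intro h
  have := one_sub_qExp (scaling m u) y
  rw [h, sub_self] at this
  have hs : Complex.sin (scaling m u / 2 * y) ≠ 0 := by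
    exact_mod_cast (sin_scaling_pos (m := m) h1 h2 hy hy').ne'
  simp [qExp_ne_zero, hs] at this

lemma neg_qExp_ne_one {m : ℕ} {u : Fin 4 → ℝ} (h1 : 0 < u 0) (h2 : 0 < u 1) {y : ℝ}
    (hy : |y| < u 0 + u 1 + m) : -qExp (scaling m u) y ≠ 1 := by
  intro h
  have := one_add_qExp (scaling m u) y
  rw [← neg_neg (qExp _ _), h, add_neg_cancel] at this
  have hs : Complex.cos (scaling m u / 2 * y) ≠ 0 := by
    exact_mod_cast (cos_scaling_pos (m := m) h1 h2 hy).ne'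
  simp [qExp_ne_zero, hs] at this

lemma racahDenom_ne_zero {m : ℕ} {u v : Fin 4 → ℝ} (h1 : 0 < u 0) (h2 : 0 < u 1)
    (hv1 : |v 0| < u 0 + 1 / 2) (hv2 : |v 1| < u 1 + 1 / 2) {α : ℝ} (hα : α = scaling m u)
    {l : ℕ} (hl : l ≤ m) :
    racahDenom (qExp α 1) (parA α u) (parB α u) (parC α u v) (parD α u v) l ≠ 0 := by
  obtain ⟨a1, a2⟩ := abs_lt.1 hv1
  obtain ⟨b1, b2⟩ := abs_lt.1 hv2
  have hcast : ∀ i < l, (i : ℝ) + 1 ≤ m := fun i hi => by exact_mod_cast hi.trans_le hl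
  have hi0 : ∀ i : ℕ, (0 : ℝ) ≤ i := fun i => i.cast_nonneg
  refine mul_ne_zero (mul_ne_zero (mul_ne_zero ?_ ?_) ?_) ?_ <;>
    refine qPoch_ne_zero fun i hi => ?_ <;>
    have hi1 := hcast i hi <;> have hi2 := hi0 i
  · have := neg_qExp_ne_one (m := m) h1 h2 (y := u 0 + u 1 + i)
      (abs_lt.2 ⟨by linarith, by linarith⟩)
    convert this using 1
    simp only [← hα, qExp_one_pow, parA, neg_mul, ← qExp_add]
    push_cast
    ring_nf
  · have := qExp_ne_one (m := m) h1 h2 (y := u 0 + v 0 + 1 / 2 + i)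
      (by linarith) (by linarith)
    convert this using 1
    simp only [← hα, qExp_one_pow, parB, parD, neg_mul, mul_neg, neg_neg, ← qExp_add]
    push_cast
    ring_nf
  · have := neg_qExp_ne_one (m := m) h1 h2 (y := u 0 + v 1 + 1 / 2 + i)
      (abs_lt.2 ⟨by linarith, by linarith⟩)
    convert this using 1
    simp only [← hα, qExp_one_pow, parC, neg_mul, ← qExp_add]
    push_cast
    ring_nf
  · have := qExp_ne_one (m := m) h1 h2 (y := 1 + i) (by linarith) (by linarith)
    convert this using 1
    simp only [← hα, qExp_one_pow, ← qExp_add]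
    push_cast
    rfl

/-- The polynomial `R_k` truncated at order `m`, as a function of its degree. -/
def limitPoly (m : ℕ) (u v : Fin 4 → ℝ) (x : ℂ) (k : ℕ) : ℂ :=
  racahSum (qExp (scaling m u) 1) (parA (scaling m u) u) (parB (scaling m u) u)
    (parC (scaling m u) u v) (parD (scaling m u) u v) (qExp (scaling m u) k)
    (qExp (scaling m u) (-x))
    (parC (scaling m u) u v * parD (scaling m u) u v * qExp (scaling m u) (x + 1)) m

lemma limitPoly_zero {m : ℕ} (u v : Fin 4 → ℝ) (x : ℂ) : limitPoly m u v x 0 = 1 := by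
  rw [limitPoly, racahSum, Finset.sum_eq_single_of_mem 0 (by simp)]
  · simp [racahCoeff, degreeFactor, racahDenom, spectralFactor]
  · intro l _ hl
    rw [← qExp_one_pow, racahCoeff_eq_zero (qExp_ne_zero _ _) _ _ _ _ (Nat.pos_of_ne_zero hl),
      zero_mul]

/-- The sum is cut at m, so the boundary term must vanish: for k < m its coefficient contains
(q^{-k};q)_m = 0, and for k = m one needs (q^{-x};q)_{m+1} = 0, that is, x = j ≤ m suffices. -/
lemma limitPoly_recurrence {m : ℕ} (hm : 1 ≤ m) {u v : Fin 4 → ℝ} (w : ℝ) (h1 : 0 < u 0)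
    (h2 : 0 < u 1) (hv1 : |v 0| < u 0 + 1 / 2) (hv2 : |v 1| < u 1 + 1 / 2)
    (hs1 : u 0 = 1 / 2 → v 0 = 0) (hs2 : u 1 = 1 / 2 → v 1 = 0)
    {k : ℕ} (hk : k ≤ m) {x : ℂ} (hx : k < m ∨ ∃ j ≤ m, x = (j : ℕ)) :
    (trigEntry m u v w k k : ℂ) * limitPoly m u v x k +
      trigA (scaling m u) u v (u 0 + k) * limitPoly m u v x (k + 1) +
      trigA (scaling m u) u v (-(u 0 + k)) * limitPoly m u v x (k - 1) =
    trigE m u v w x * limitPoly m u v x k := by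
  obtain ⟨α, hα⟩ : ∃ α, α = scaling m u := ⟨_, rfl⟩
  have hk' : (k : ℝ) ≤ m := by exact_mod_cast hk
  have hm' : (1 : ℝ) ≤ m := by exact_mod_cast hm
  have hk0 : (0 : ℝ) ≤ k := k.cast_nonneg
  have hcd : parC α u v * parD α u v * qExp α 1 = qExp α (u 0 + u 1 + v 0 + v 1) := by
    simp only [parC, parD, neg_mul, mul_neg, neg_neg, ← qExp_add]
    ring_nf
  have hD : 1 - parA α u * parB α u * qExp α k ^ 2 * qExp α 1 ≠ 0 := by
    have := qExp_ne_one (m := m) h1 h2 (y := 2 * (u 0 + k)) (by linarith) (by linarith)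
    rw [← hα] at this
    rw [sub_ne_zero]
    convert this.symm using 1
    simp only [parA, parB, neg_mul, mul_neg, neg_neg, pow_two, ← qExp_add]
    push_cast
    ring_nf
  have hD' : 1 - parA α u * parB α u * qExp α k * qExp α 1 ≠ 0 := by
    have := qExp_ne_one (m := m) h1 h2 (y := 2 * u 0 + k) (by linarith) (by linarith)
    rw [← hα] at this
    rw [sub_ne_zero]
    convert this.symm using 1
    simp only [parA, parB, neg_mul, mul_neg, neg_neg, ← qExp_add]
    push_cast
    ring_nf
  have hC0 : qExp α k = 1 →
      qExp α ((u 0 + u 1 + v 0 + v 1) / 2) * (trigA α u v (-(u 0 + k)) : ℂ) = 0 := by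
    intro h
    rcases Nat.eq_zero_or_pos k with rfl | hk1
    · simp [trigA_neg_zero]
    · have hk2 : (0 : ℝ) < k := by exact_mod_cast hk1
      rw [hα] at h
      exact absurd (by exact_mod_cast h) (qExp_ne_one (m := m) h1 h2 hk2 (by linarith))
  have hxy : qExp α (-x) * (parC α u v * parD α u v * qExp α (x + 1)) =
      parC α u v * parD α u v * qExp α 1 := by
    rw [mul_left_comm, ← qExp_add]
    ring_nf
  have hend : racahCoeff (qExp α 1) (parA α u) (parB α u) (parC α u v) (parD α u v) (qExp α k) m *
      spectralFactor (qExp α 1) (qExp α (-x))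
        (parC α u v * parD α u v * qExp α (x + 1)) (m + 1) = 0 := by
    rcases hx with h | ⟨j, hj, rfl⟩
    · rw [← qExp_one_pow, racahCoeff_eq_zero (qExp_ne_zero _ _) _ _ _ _ h, zero_mul]
    · rw [spectralFactor, qPoch_eq_zero (i := j) (by omega), zero_mul, mul_zero]
      rw [qExp_one_pow, ← qExp_add, neg_add_cancel, qExp_zero]
  have hrec := racahSum_recurrence (qExp_ne_zero α 1) (qExp_ne_zero α k)
    (racah_upper_coefficient v h1 h2 hk hα rfl rfl rfl rfl rfl rfl)
    (racah_lower_coefficient v h1 h2 hk hα rfl rfl rfl rfl rfl rfl) hC0 hD hD' hxy m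
    (fun l hl => racahDenom_ne_zero h1 h2 hv1 hv2 hα hl) hend
  have hup : qExp α k * qExp α 1 = qExp α ((k + 1 : ℕ) : ℂ) := by
    rw [← qExp_add]
    push_cast
    rfl
  have hFk : ∀ k, racahSum (qExp α 1) (parA α u) (parB α u) (parC α u v) (parD α u v)
      (qExp α ((k : ℕ) : ℂ)) (qExp α (-x)) (parC α u v * parD α u v * qExp α (x + 1)) m =
      limitPoly m u v x k := by
    intro k
    rw [limitPoly, hα]
  -- At k = 0 the natural-number value of k - 1 is immaterial because A(-u₁) = 0.
  have hdown : trigA α u v (-(u 0 + k)) * racahSum (qExp α 1) (parA α u) (parB α u)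
      (parC α u v) (parD α u v) (qExp α k / qExp α 1) (qExp α (-x))
      (parC α u v * parD α u v * qExp α (x + 1)) m =
      trigA α u v (-(u 0 + k)) * limitPoly m u v x (k - 1) := by
    cases k with
    | zero => simp [trigA_neg_zero]
    | succ k =>
      have : qExp α ((k + 1 : ℕ) : ℂ) / qExp α 1 = qExp α (k : ℂ) := by
        rw [← qExp_one_pow, ← qExp_one_pow, pow_succ, mul_div_cancel_right₀ _ (qExp_ne_zero α 1)]
      rw [this, hFk, Nat.add_sub_cancel]
  rw [hup, hFk, hFk] at hrec
  have hdiag := congrArg ((↑) : ℝ → ℂ) (trigA_add_trigA_neg_eq hm h1 h2 hs1 hs2 hk)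
  rw [← hα] at hdiag
  push_cast at hdiag
  have hspec : qExp α (-x) + parC α u v * parD α u v * qExp α (x + 1) - 1 -
      parC α u v * parD α u v * qExp α 1 = qExp α ((u 0 + u 1 + v 0 + v 1) / 2) *
      (2 * Complex.cos (α / 2 * (2 * x + u 0 + u 1 + v 0 + v 1)) -
        2 * Complex.cos (α / 2 * (u 0 + u 1 + v 0 + v 1))) := by
    have e1 := one_add_qExp α (2 * x + u 0 + u 1 + v 0 + v 1)
    have e2 := one_add_qExp α (u 0 + u 1 + v 0 + v 1)
    have e3 : parC α u v * parD α u v * qExp α (x + 1) =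
        qExp α (-x) * qExp α (2 * x + u 0 + u 1 + v 0 + v 1) := by
      rw [add_comm x, qExp_add, ← mul_assoc, hcd, ← qExp_add, ← qExp_add]
      ring_nf
    have e4 : qExp α (-x) * qExp α ((2 * x + u 0 + u 1 + v 0 + v 1) / 2) =
        qExp α ((u 0 + u 1 + v 0 + v 1) / 2) := by
      rw [← qExp_add]
      ring_nf
    rw [e3, hcd]
    linear_combination qExp α (-x) * e1 - e2 +
      2 * Complex.cos (α / 2 * (2 * x + u 0 + u 1 + v 0 + v 1)) * e4
  rw [hspec] at hrec
  have hentry : (trigEntry m u v w k k : ℂ) =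
      ∑ r : Fin 4, (trigC α u v w r : ℂ) + trigBeta α u v (u 0 + k) := by
    simp [trigEntry, hα]
  rw [hentry, trigE, ← hα]
  apply mul_left_cancel₀ (qExp_ne_zero α ((u 0 + u 1 + v 0 + v 1) / 2))
  linear_combination hrec + qExp α ((u 0 + u 1 + v 0 + v 1) / 2) * limitPoly m u v x k * hdiag -
    qExp α ((u 0 + u 1 + v 0 + v 1) / 2) * hdown

/-! ### Convergence of the characteristic polynomials -/

lemma tendsto_leadingMinor {R X : Type*} [CommRing R] [TopologicalSpace R]
    [IsTopologicalRing R] {l : Filter X} {f : X → ℕ → ℕ → R} {T : ℕ → ℕ → R} {k : ℕ}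
    (h : ∀ i < k, ∀ j < k, Tendsto (fun p => f p i j) l (𝓝 (T i j))) :
    Tendsto (fun p => leadingMinor (f p) k) l (𝓝 (leadingMinor T k)) := by
  have hdet : Continuous fun M : Matrix (Fin k) (Fin k) R => M.det :=
    Continuous.matrix_det continuous_id
  refine (hdet.tendsto _).comp ?_
  exact tendsto_pi_nhds.2 fun i => tendsto_pi_nhds.2 fun j => h i i.2 j j.2

/-- The entries of `E I - H` for a matrix `H`. -/
def charEntry {R : Type*} [CommRing R] (E : R) (H : ℕ → ℕ → R) (i j : ℕ) : R :=
  (if i = j then E else 0) - H i j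

lemma monicPoly_eq_leadingMinor (m : ℕ) (p : ℝ) (u v : Fin 4 → ℝ) (w : ℝ) (k : ℕ) (E : ℂ) :
    monicPoly m p u v w k E =
      leadingMinor (charEntry E fun i j => (heunEntry m p u v w i j : ℂ)) k := by
  simp only [monicPoly, leadingMinor, charEntry, Fin.ext_iff]

lemma eval_charpoly_eq_leadingMinor {R : Type*} [CommRing R] (H : ℕ → ℕ → R) (n : ℕ) (t : R) :
    (Matrix.of fun i j : Fin n => H i j).charpoly.eval t = leadingMinor (charEntry t H) n := by
  rw [Matrix.eval_charpoly, leadingMinor]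
  congr 1
  ext i j
  simp [charEntry, Matrix.diagonal_apply, Fin.ext_iff]

lemma ofReal_leadingMinor_charEntry (H : ℕ → ℕ → ℝ) (t : ℝ) (k : ℕ) :
    ((leadingMinor (charEntry t H) k : ℝ) : ℂ) =
      leadingMinor (charEntry (t : ℂ) fun i j => (H i j : ℂ)) k := by
  change Complex.ofRealHom _ = _
  rw [leadingMinor, RingHom.map_det, leadingMinor]
  congr 1
  ext i j
  simp only [charEntry, RingHom.mapMatrix_apply, Matrix.map_apply, Matrix.of_apply, map_sub]
  split_ifs <;> simp

/-- At order m + 1 the last row enters, whence the restriction of x to {0,…,m} there. -/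
lemma leadingMinor_trigEntry {m : ℕ} (hm : 1 ≤ m) {u v : Fin 4 → ℝ} (w : ℝ) (h1 : 0 < u 0)
    (h2 : 0 < u 1) (hv1 : |v 0| < u 0 + 1 / 2) (hv2 : |v 1| < u 1 + 1 / 2)
    (hs1 : u 0 = 1 / 2 → v 0 = 0) (hs2 : u 1 = 1 / 2 → v 1 = 0)
    {x : ℂ} {k : ℕ} (hk : k ≤ m + 1) (hx : k ≤ m ∨ ∃ j ≤ m, x = (j : ℕ)) :
    leadingMinor (charEntry (trigE m u v w x) fun i j => (trigEntry m u v w i j : ℂ)) k =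
      limitPoly m u v x k * ∏ j ∈ Finset.range k, (trigA (scaling m u) u v (u 0 + j) : ℂ) := by
  have hrec : ∀ i, i < k → _ := fun i hi =>
    limitPoly_recurrence (k := i) (x := x) hm w h1 h2 hv1 hv2 hs1 hs2 (by omega)
      (hx.imp (fun h => by omega) id)
  have hsup : ∀ i, trigEntry m u v w i (i + 1) = trigA (scaling m u) u v (u 0 + i) := by
    intro i
    simp [trigEntry]
  have hsub : ∀ i : ℕ, trigEntry m u v w (i + 1) i =
      trigA (scaling m u) u v (-(u 0 + (i + 1 : ℕ))) := by
    intro i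
    simp [trigEntry, show i ≠ i + 1 + 1 by omega]
  rw [leadingMinor_eq_mul_prod _ ?_ ?_ (limitPoly m u v x) k (limitPoly_zero u v x) ?_ ?_ le_rfl]
  · congr 1
    refine Finset.prod_congr rfl fun j _ => ?_
    simp [charEntry, hsup]
  · intro i j hij
    simp [charEntry, trigEntry, show i ≠ j by omega, show j ≠ i + 1 by omega,
      show i ≠ j + 1 by omega]
  · intro i j hij
    simp [charEntry, trigEntry, show i ≠ j by omega, show j ≠ i + 1 by omega,
      show i ≠ j + 1 by omega]
  · intro h0
    have h := hrec 0 h0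
    simp only [Nat.cast_zero, add_zero, trigA_neg_zero] at h
    simp only [charEntry, ite_true, hsup, zero_ne_one, ite_false, Nat.cast_zero, add_zero]
    push_cast at h
    linear_combination -h
  · intro i hi
    have h := hrec (i + 1) hi
    simp only [charEntry, ite_true, hsup, hsub, Nat.succ_ne_self, (Nat.succ_ne_self _).symm,
      ite_false]
    rw [Nat.add_sub_cancel] at h
    linear_combination -h

/-- The limits of the eigenvalues. -/
def trigEigenvalue (m : ℕ) (u v : Fin 4 → ℝ) (w : ℝ) (j : ℕ) : ℝ :=
  2 * Real.cos (scaling m u / 2 * (2 * j + u 0 + u 1 + v 0 + v 1)) +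
    ∑ r : Fin 4, trigC (scaling m u) u v w r

lemma ofReal_trigEigenvalue (m : ℕ) (u v : Fin 4 → ℝ) (w : ℝ) (j : ℕ) :
    (trigEigenvalue m u v w j : ℂ) = trigE m u v w j := by
  simp [trigEigenvalue, trigE]

/-- Consecutive values differ by 4 sin(α(2i+1+u₁+u₂+v₁+v₂)/2) sin(α/2), and the bounds on v₁ and v₂
put the first argument into (0, π). -/
lemma strictAnti_trigEigenvalue {m : ℕ} (hm : 1 ≤ m) {u v : Fin 4 → ℝ} (w : ℝ) (h1 : 0 < u 0)
    (h2 : 0 < u 1) (hv1 : |v 0| < u 0 + 1 / 2) (hv2 : |v 1| < u 1 + 1 / 2) :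
    StrictAnti fun j : Fin (m + 1) => trigEigenvalue m u v w j := by
  obtain ⟨a1, a2⟩ := abs_lt.1 hv1
  obtain ⟨b1, b2⟩ := abs_lt.1 hv2
  rw [Fin.strictAnti_iff_succ_lt]
  intro i
  have hi : (i : ℝ) + 1 ≤ m := by exact_mod_cast i.2
  have hi0 : (0 : ℝ) ≤ (i : ℕ) := Nat.cast_nonneg _
  have hm' : (1 : ℝ) ≤ m := by exact_mod_cast hm
  have e1 := sin_scaling_pos (m := m) h1 h2 (y := 2 * i + 1 + u 0 + u 1 + v 0 + v 1)
    (by linarith) (by linarith)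
  have e2 := sin_scaling_pos (m := m) h1 h2 (y := 1) one_pos (by linarith)
  have e3 := Real.two_mul_sin_mul_sin
    (scaling m u / 2 * (2 * i + 1 + u 0 + u 1 + v 0 + v 1)) (scaling m u / 2 * 1)
  rw [← mul_sub, ← mul_add] at e3
  have e4 : (2 * (i : ℝ) + 1 + u 0 + u 1 + v 0 + v 1) - 1 =
      2 * i + u 0 + u 1 + v 0 + v 1 := by ring
  have e5 : (2 * (i : ℝ) + 1 + u 0 + u 1 + v 0 + v 1) + 1 =
      2 * (i + 1) + u 0 + u 1 + v 0 + v 1 := by ring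
  rw [e4, e5] at e3
  simp only [trigEigenvalue, Fin.val_succ, Fin.val_castSucc]
  push_cast
  nlinarith [mul_pos e1 e2]

open Polynomial in
lemma eval_eq_prod_of_roots {n : ℕ} {r : Fin n → ℝ} (hr : StrictAnti r) {P : ℝ[X]}
    (hP : P.Monic) (hdeg : P.natDegree = n) (hroot : ∀ j, P.eval (r j) = 0) (t : ℝ) :
    P.eval t = ∏ i, (t - r i) := by
  have hroots : P.roots = (List.ofFn r : Multiset ℝ) := by
    rw [← sort_roots_eq_ofFn hr hP hdeg hroot, Multiset.sort_eq]
  have h := prod_multiset_X_sub_C_of_monic_of_roots_card_eq hP (by simp [hroots, hdeg])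
  rw [← h, hroots, eval_multiset_prod]
  simp [List.prod_ofFn, Function.comp_def]

lemma tendsto_eval_charpoly {m : ℕ} (hm : 1 ≤ m) {u v : Fin 4 → ℝ} {w : ℝ} (h1 : 0 < u 0)
    (h2 : 0 < u 1) (hv1 : |v 0| < u 0 + 1 / 2) (hv2 : |v 1| < u 1 + 1 / 2)
    (hs1 : u 0 = 1 / 2 → v 0 = 0) (hs2 : u 1 = 1 / 2 → v 1 = 0)
    (hw : ∀ n : ℤ, w ≠ n * (2 * Real.pi / scaling m u) ∧
      w + 1 ≠ n * (2 * Real.pi / scaling m u)) (t : ℝ) :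
    Tendsto (fun p => (heunMatrix m p u v w).charpoly.eval t) (𝓝[>] 0)
      (𝓝 (∏ i : Fin (m + 1), (t - trigEigenvalue m u v w i))) := by
  rw [← eval_eq_prod_of_roots (strictAnti_trigEigenvalue hm w h1 h2 hv1 hv2)
    (Matrix.charpoly_monic (Matrix.of fun i j : Fin (m + 1) => trigEntry m u v w i j))
    (by simp [Matrix.charpoly_natDegree_eq_dim]), eval_charpoly_eq_leadingMinor]
  · simp only [heunMatrix, eval_charpoly_eq_leadingMinor]
    refine tendsto_leadingMinor fun i hi j hj => ?_
    exact (tendsto_heunEntry hm h1 h2 v hw (by omega) (by omega)).const_sub _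
  · intro j
    rw [eval_charpoly_eq_leadingMinor]
    apply Complex.ofReal_injective
    -- The full determinant contains the factor A(u₁+m) = 0, so E_j is a root whatever the value of
    -- `limitPoly` at degree m + 1.
    rw [ofReal_leadingMinor_charEntry, ofReal_trigEigenvalue,
      leadingMinor_trigEntry hm w h1 h2 hv1 hv2 hs1 hs2 le_rfl (Or.inr ⟨j, by omega, rfl⟩),
      Finset.prod_range_succ, trigA_last v h1 h2]
    simp

lemma tendsto_normalizedPoly {m : ℕ} (hm : 1 ≤ m) {u v : Fin 4 → ℝ} {w : ℝ} (h1 : 0 < u 0)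
    (h2 : 0 < u 1) (hv1 : |v 0| < u 0 + 1 / 2) (hv2 : |v 1| < u 1 + 1 / 2)
    (hs1 : u 0 = 1 / 2 → v 0 = 0) (hs2 : u 1 = 1 / 2 → v 1 = 0)
    (hw : ∀ n : ℤ, w ≠ n * (2 * Real.pi / scaling m u) ∧
      w + 1 ≠ n * (2 * Real.pi / scaling m u)) {k : ℕ} (hk : k ≤ m) (x : ℂ) :
    Tendsto (fun p => normalizedPoly m p u v w k (trigE m u v w x)) (𝓝[>] 0)
      (𝓝 (limitPoly m u v x k)) := by
  have hne : ∀ j ∈ Finset.range k, (trigA (scaling m u) u v (u 0 + j) : ℂ) ≠ 0 := fun j hj => by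
    exact_mod_cast trigA_ne_zero h1 h2 hv1 hv2 ((Finset.mem_range.1 hj).trans_le hk)
  have hprod : Tendsto (fun p => ∏ j ∈ Finset.range k, ((upperCoef m p u v (m - j) : ℂ))⁻¹)
      (𝓝[>] 0) (𝓝 (∏ j ∈ Finset.range k, (trigA (scaling m u) u v (u 0 + j) : ℂ)⁻¹)) :=
    tendsto_finsetProd _ fun j hj => ((Complex.continuous_ofReal.tendsto _).comp
      (tendsto_upperCoef h1 h2 v ((Finset.mem_range.1 hj).trans_le hk))).inv₀ (hne j hj)
  have hminor : Tendsto (fun p => monicPoly m p u v w k (trigE m u v w x)) (𝓝[>] 0)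
      (𝓝 (leadingMinor (charEntry (trigE m u v w x)
        fun i j => (trigEntry m u v w i j : ℂ)) k)) := by
    simp only [monicPoly_eq_leadingMinor]
    refine tendsto_leadingMinor fun i hi j hj => ?_
    exact ((Complex.continuous_ofReal.tendsto _).comp
      (tendsto_heunEntry hm h1 h2 v hw (by omega) (by omega))).const_sub _
  simp only [normalizedPoly]
  convert hminor.mul hprod using 2
  rw [leadingMinor_trigEntry hm w h1 h2 hv1 hv2 hs1 hs2 (by omega) (Or.inl hk), mul_assoc,
    ← Finset.prod_mul_distrib, Finset.prod_eq_one, mul_one]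
  intro j hj
  exact mul_inv_cancel₀ (hne j hj)

lemma scaling_lt_pi {m : ℕ} (hm : 1 ≤ m) {u : Fin 4 → ℝ} (h1 : 0 < u 0) (h2 : 0 < u 1) :
    scaling m u < Real.pi := by
  have hm' : (1 : ℝ) ≤ m := by exact_mod_cast hm
  exact div_lt_self Real.pi_pos (by linarith)

lemma qRacah_eq_phi43 {α : ℝ} (h0 : 0 < α) (h1 : α < Real.pi) (u v : Fin 4 → ℝ) (k : ℕ) (x : ℂ)
    {q : ℂ} (hq : q = Complex.exp (Complex.I * α)) :
    qRacah k x (-q ^ (u 0 + u 1 - 1 : ℂ)) (-q ^ (u 0 - u 1 : ℂ))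
        (-q ^ (u 0 + v 1 - 1 / 2 : ℂ)) (-q ^ (u 1 + v 0 - 1 / 2 : ℂ)) q =
      phi43 (q ^ (-(k : ℂ))) (q ^ (2 * u 0 + k : ℂ)) (q ^ (-x))
        (q ^ (u 0 + u 1 + v 0 + v 1 + x : ℂ))
        (-q ^ (u 0 + u 1 : ℂ)) (q ^ (u 0 + v 0 + 1 / 2 : ℂ))
        (-q ^ (u 0 + v 1 + 1 / 2 : ℂ)) q q := by
  have hpow : ∀ y, q ^ y = qExp α y := fun y => by rw [hq, cpow_eq_qExp h0 h1]
  have hq1 : q = qExp α 1 := by rw [hq, qExp, mul_one]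
  have e0 : q ^ (k + 1) = qExp α (k + 1) := by rw [hq1, qExp_one_pow]; push_cast; rfl
  have e1 : -q ^ (u 0 + u 1 - 1 : ℂ) * -q ^ (u 0 - u 1 : ℂ) * q ^ (k + 1) =
      q ^ (2 * u 0 + k : ℂ) := by
    rw [e0]
    simp only [hpow, neg_mul, mul_neg, neg_neg, ← qExp_add]
    ring_nf
  have e2 : -q ^ (u 0 + v 1 - 1 / 2 : ℂ) * -q ^ (u 1 + v 0 - 1 / 2 : ℂ) * q ^ (x + 1) =
      q ^ (u 0 + u 1 + v 0 + v 1 + x : ℂ) := by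
    simp only [hpow, neg_mul, mul_neg, neg_neg, ← qExp_add]
    ring_nf
  have hmul : ∀ y z : ℂ, y + 1 = z → q ^ y * q = q ^ z := by
    rintro y z rfl
    rw [hpow, hpow, hq1, qExp_add]
  have e3 : -q ^ (u 0 + u 1 - 1 : ℂ) * q = -q ^ (u 0 + u 1 : ℂ) := by
    rw [neg_mul, hmul _ (u 0 + u 1) (by ring)]
  have e4 : -q ^ (u 0 - u 1 : ℂ) * -q ^ (u 1 + v 0 - 1 / 2 : ℂ) * q =
      q ^ (u 0 + v 0 + 1 / 2 : ℂ) := by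
    rw [neg_mul_neg, hpow, hpow, ← qExp_add, ← hpow, hmul _ (u 0 + v 0 + 1 / 2) (by ring)]
  have e5 : -q ^ (u 0 + v 1 - 1 / 2 : ℂ) * q = -q ^ (u 0 + v 1 + 1 / 2 : ℂ) := by
    rw [neg_mul, hmul _ (u 0 + v 1 + 1 / 2) (by ring)]
  rw [qRacah, e1, e2, e3, e4, e5]

end EllipticRacah

end

/-! ### The limit theorem -/

theorem proposition4p1 (m : ℕ) (hm : 1 ≤ m) (u v : Fin 4 → ℝ) (w : ℝ)
    (hu1 : 0 < u 0) (hu2 : 0 < u 1)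
    (hv1 : |v 0| < u 0 + 1 / 2) (hv2 : |v 1| < u 1 + 1 / 2)
    -- the two degenerate cases in which `A(-u₁)` or `A(u₁ + m)` does not vanish
    (hs1 : u 0 = 1 / 2 → v 0 = 0) (hs2 : u 1 = 1 / 2 → v 1 = 0)
    (hw : ∀ n : ℤ, w ≠ n * (2 * Real.pi / EllipticRacah.scaling m u) ∧
      w + 1 ≠ n * (2 * Real.pi / EllipticRacah.scaling m u)) :
    -- near `p = 0` the numbers `E_0 > ... > E_m` are `m + 1` distinct eigenvalues of `H`
    (∀ᶠ p in 𝓝[>] (0 : ℝ),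
      (StrictAnti fun j : Fin (m + 1) => EllipticRacah.eigenvalue m p u v w j) ∧
      ∀ j : Fin (m + 1), Module.End.HasEigenvalue
        (Matrix.toLin' (EllipticRacah.heunMatrix m p u v w))
        (EllipticRacah.eigenvalue m p u v w j)) ∧
    (∀ j : ℕ, j ≤ m →
      Tendsto (fun p => EllipticRacah.eigenvalue m p u v w j) (𝓝[>] (0 : ℝ))
        (𝓝 (2 * Real.cos (EllipticRacah.scaling m u / 2 *
            (2 * j + u 0 + u 1 + v 0 + v 1)) +
          ∑ r : Fin 4, EllipticRacah.trigC (EllipticRacah.scaling m u) u v w r))) ∧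
    ∀ q : ℂ, q = Complex.exp (Complex.I * EllipticRacah.scaling m u) →
      ∀ k : ℕ, k ≤ m → ∀ x : ℂ,
        Tendsto (fun p => EllipticRacah.normalizedPoly m p u v w k
            (EllipticRacah.trigE m u v w x)) (𝓝[>] (0 : ℝ))
          (𝓝 (EllipticRacah.qRacah k x
            (-q ^ (u 0 + u 1 - 1 : ℂ)) (-q ^ (u 0 - u 1 : ℂ))
            (-q ^ (u 0 + v 1 - 1 / 2 : ℂ)) (-q ^ (u 1 + v 0 - 1 / 2 : ℂ)) q)) ∧
        EllipticRacah.qRacah k x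
            (-q ^ (u 0 + u 1 - 1 : ℂ)) (-q ^ (u 0 - u 1 : ℂ))
            (-q ^ (u 0 + v 1 - 1 / 2 : ℂ)) (-q ^ (u 1 + v 0 - 1 / 2 : ℂ)) q =
          EllipticRacah.phi43 (q ^ (-(k : ℂ))) (q ^ (2 * u 0 + k : ℂ)) (q ^ (-x))
            (q ^ (u 0 + u 1 + v 0 + v 1 + x : ℂ))
            (-q ^ (u 0 + u 1 : ℂ)) (q ^ (u 0 + v 0 + 1 / 2 : ℂ))
            (-q ^ (u 0 + v 1 + 1 / 2 : ℂ)) q q := by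
  have hα := EllipticRacah.scaling_pos (m := m) hu1 hu2
  have hαπ := EllipticRacah.scaling_lt_pi hm hu1 hu2
  have hroots := EllipticRacah.sort_roots_tendsto
    (EllipticRacah.strictAnti_trigEigenvalue hm w hu1 hu2 hv1 hv2)
    (fun p => Matrix.charpoly_monic (EllipticRacah.heunMatrix m p u v w))
    (fun p => by simp [Matrix.charpoly_natDegree_eq_dim])
    (EllipticRacah.tendsto_eval_charpoly hm hu1 hu2 hv1 hv2 hs1 hs2 hw)
  refine ⟨?_, fun j hj => ?_, ?_⟩
  · filter_upwards [hroots.1] with p ⟨r, hr, hr0, hsort⟩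
    have heig : ∀ j : Fin (m + 1), EllipticRacah.eigenvalue m p u v w j = r j := fun j => by
      rw [EllipticRacah.eigenvalue, hsort, List.getD_eq_getElem _ _ (by simp [Fin.is_le]),
        List.getElem_ofFn]
    simp only [heig]
    refine ⟨hr, fun j => ?_⟩
    rw [Module.End.hasEigenvalue_iff_isRoot_charpoly, Matrix.charpoly_toLin']
    exact hr0 j
  · exact hroots.2 ⟨j, Nat.lt_succ_of_le hj⟩
  · intro q hq k hk x
    refine ⟨?_, EllipticRacah.qRacah_eq_phi43 hα hαπ u v k x hq⟩
    have hpow : ∀ y, q ^ y = EllipticRacah.qExp (EllipticRacah.scaling m u) y := fun y => by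
      rw [hq, EllipticRacah.cpow_eq_qExp hα hαπ]
    have hq1 : q = EllipticRacah.qExp (EllipticRacah.scaling m u) 1 := by
      rw [hq, EllipticRacah.qExp, mul_one]
    have hq0 : q ≠ 0 := hq ▸ Complex.exp_ne_zero _
    rw [EllipticRacah.qRacah_eq_racahSum hq0 _ _ _ _ _ hk]
    simp only [hpow]
    rw [hq1, EllipticRacah.qExp_one_pow]
    exact EllipticRacah.tendsto_normalizedPoly hm hu1 hu2 hv1 hv2 hs1 hs2 hw hk x
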